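/- Let $Q=(Q_0,Q_1)$ be a finite quiver which is acyclic (it has no oriented cycles, in particular no loops); representations are finite-dimensional over $\mathbb C$. Let $\chi_Q(d,d')=\sum_i d_id'_i-\sum_{a:i\to j}d_id'_j$ be the Euler form on $\mathbb Z^{Q_0}$ and $\langle d,d'\rangle=\chi_Q(d,d')-\chi_Q(d',d)$. For a weight $\theta\in\mathbb R^{Q_0}$, put $\theta(d)=\sum_i\theta_id_i$. A representation $M$ is $\theta$-semistable if $\theta(\underline{\dim}M)=0$ and $\theta(\underline{\dim}N)\le 0$ for all subrepresentations $N\subset M$; it is $\theta$-stable if moreover $M\neq0$ and $\theta(\underline{\dim} N)<0$ for all $0\ne N\subsetneq M$. It is self-stable if it is $\theta$-stable for $\theta=\langle -,\underline{\dim}M\rangle$. For $d\in\mathbb N^{Q_0}$ let $R^\theta(Q,d)$ be the variety of $\theta$-semistable points of $\bigoplus_{a:i\to j}\mathrm{Hom}(\mathbb C^{d_i},\mathbb C^{d_j})$, let $G_d=\prod_i\mathrm{GL}_{d_i}(\mathbb C)$, and let $P(X)=P(X;y)=\sum_{i,k}(-1)^i\dim \mathrm{Gr}^W_kH^i_c(X,\mathbb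 Q)\,y^k$ be the virtual Poincaré polynomial. Put $$\mathcal A_\theta(x)=\sum_{\theta(d)=0}(-y)^{\chi_Q(d,d)}\frac{P(R^\theta(Q,d))}{P(G_d)}\,x^d\in\mathbb Q(y)[[x_i : i\in Q_0]],$$ and let $\mathrm{Exp}(f)=\exp\bigl(\sum_{m\ge1}\tfrac1m f(y^m,x^m)\bigr)$. A weight $\theta$ is generic if $\{d\in\mathbb Z^{Q_0}:\theta(d)=0\}$ has rank one; for such $\theta$ the integer DT invariants $\Omega_\theta(d,y)\in\mathbb Q(y)$ are defined by $$\mathcal A_\theta(x)=\mathrm{Exp}\Bigl(\frac{\sum_{\theta(d)=0,\ d\ne0}\Omega_\theta(d,y)\,x^d}{y^{-1}-y}\Bigr).$$ For $0\neq d\in\mathbb N^{Q_0}$, the attractor invariant $\Omega_*(d,y)$ is $\Omega_{\theta}(d,y)$ for every generic $\theta$ with $\theta(d)=0$ which is sufficiently close to $\langle-,d\rangle$. Then: 1. A representation of $Q$ is self-stable if and only if it is isomorphic to the simple representation $S_j$ (one-dimensional at $j$, zero elsewhere) for some vertex $j\in Q_0$. 2. For every $0\ne d\in\mathbb N^{Q_0}$,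 the attractor invariant $\Omega_*(d,y)$ is well defined, with $\Omega_*(d,y)=1$ if $d=e_i$ for some $i\in Q_0$, and $\Omega_*(d,y)=0$ otherwise. 3. In $\mathbb Q(y)[[x]]$, $$\sum_{n\ge0}\frac{(-y)^{n^2}}{P(\mathrm{GL}_n)}x^n=\mathrm{Exp}\Bigl(\frac{x}{y^{-1}-y}\Bigr).$$ -/

import Mathlib

open scoped Topology
open Polynomial (X C)

namespace QuiverDT

noncomputable section

/-! ## Quivers, representations and stability -/

section Representations

universe u v w w'

/-- A quiver is acyclic if its only closed paths are the trivial ones (no loops, no cycles). -/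
def IsAcyclicQuiver (V : Type u) [Quiver.{v} V] : Prop :=
  ∀ (i : V) (p : Quiver.Path i i), p.length = 0

/-- A finite-dimensional complex representation of a quiver. -/
structure QRep (V : Type u) [Quiver.{v} V] where
  /-- The vector space at a vertex. -/
  obj : V → Type w
  [addCommGroup : ∀ i, AddCommGroup (obj i)]
  [module : ∀ i, Module ℂ (obj i)]
  [finiteDimensional : ∀ i, FiniteDimensional ℂ (obj i)]
  /-- The linear map attached to an arrow. -/
  map : ∀ {i j : V}, (i ⟶ j) → (obj i →ₗ[ℂ] obj j)

attribute [instance] QRep.addCommGroup QRep.module QRep.finiteDimensional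

variable {V : Type u} [Quiver.{v} V]

namespace QRep

/-- The dimension vector of a representation. -/
def dimVec (M : QRep.{u, v, w} V) : V → ℕ := fun i => Module.finrank ℂ (M.obj i)

/-- A subrepresentation: subspaces at all vertices, preserved by all arrows. -/
structure Sub (M : QRep.{u, v, w} V) where
  /-- The subspace at a vertex. -/
  space : ∀ i, Submodule ℂ (M.obj i)
  map_mem : ∀ {i j : V} (a : i ⟶ j) (x : M.obj i), x ∈ space i → M.map a x ∈ space j

/-- The dimension vector of a subrepresentation. -/
def Sub.dimVec {M : QRep.{u, v, w} V} (N : M.Sub) : V → ℕ :=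
  fun i => Module.finrank ℂ (N.space i)

/-- Isomorphisms of representations. -/
structure Iso (M : QRep.{u, v, w} V) (M' : QRep.{u, v, w'} V) where
  /-- The isomorphism at a vertex. -/
  equiv : ∀ i, M.obj i ≃ₗ[ℂ] M'.obj i
  comm : ∀ {i j : V} (a : i ⟶ j) (x : M.obj i), equiv j (M.map a x) = M'.map a (equiv i x)

end QRep

/-- Coordinates on the space of representations `R(Q, d)`: for each arrow `a : i → j`, the entries
of a matrix with `d j` rows and `d i` columns. -/
abbrev RepCoord (d : V → ℕ) : Type (max u v) :=
  Σ (i : V) (j : V) (_ : i ⟶ j), Fin (d j) × Fin (d i)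

/-- The representation of dimension vector `d` given by a point of the affine space
`R(Q, d) = ⨁_{a : i → j} Hom(ℂ^{d i}, ℂ^{d j})`. -/
def repOfPoint (d : V → ℕ) (ρ : RepCoord d → ℂ) : QRep.{u, v, 0} V where
  obj i := Fin (d i) → ℂ
  map {i j} a := Matrix.toLin' (Matrix.of fun r c => ρ ⟨i, j, a, r, c⟩)

/-- The simple representation `S_j`: one-dimensional at the vertex `j`, zero at all other vertices,
with zero maps on arrows. -/
def vertexSimple [DecidableEq V] (j : V) : QRep.{u, v, 0} V :=
  repOfPoint (Pi.single j 1) 0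

variable [Fintype V]

/-- The pairing `θ(d)` of a weight with a dimension vector. -/
def weightPairing (θ : V → ℝ) (d : V → ℕ) : ℝ := ∑ i, θ i * (d i : ℝ)

/-- `M` is `θ`-semistable: `θ(M) = 0` and `θ(N) ≤ 0` for all subrepresentations `N`. -/
def QRep.IsSemistable (θ : V → ℝ) (M : QRep.{u, v, w} V) : Prop :=
  weightPairing θ M.dimVec = 0 ∧ ∀ N : M.Sub, weightPairing θ N.dimVec ≤ 0

/-- `M` is `θ`-stable: `M ≠ 0`, `θ(M) = 0`, and `θ(N) < 0` for all subrepresentations `N` other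
than `0` and `M`. -/
def QRep.IsStable (θ : V → ℝ) (M : QRep.{u, v, w} V) : Prop :=
  (∃ i, Nontrivial (M.obj i)) ∧ weightPairing θ M.dimVec = 0 ∧
    ∀ N : M.Sub, (∃ i, N.space i ≠ ⊥) → (∃ i, N.space i ≠ ⊤) → weightPairing θ N.dimVec < 0

variable [∀ i j : V, Fintype (i ⟶ j)]

/-- The Euler form `χ_Q(d, d') = ∑_i d_i d'_i - ∑_{a : i → j} d_i d'_j`. -/
def eulerForm (d d' : V → ℤ) : ℤ :=
  ∑ i, d i * d' i - ∑ i, ∑ j, (Fintype.card (i ⟶ j) : ℤ) * d i * d' j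

/-- The skew-symmetrized Euler form `⟨d, d'⟩ = χ_Q(d, d') - χ_Q(d', d)`. -/
def skewForm (d d' : V → ℤ) : ℤ := eulerForm d d' - eulerForm d' d

/-- The self-stability weight `⟨-, d⟩`; its `i`-th coordinate is `⟨e_i, d⟩`. -/
def selfWeight [DecidableEq V] (d : V → ℕ) : V → ℝ :=
  fun i => (skewForm (Pi.single i 1) (fun k => (d k : ℤ)) : ℝ)

/-- `M` is self-stable: stable for the weight `⟨-, dim M⟩`. -/
def QRep.IsSelfStable [DecidableEq V] (M : QRep.{u, v, w} V) : Prop :=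
  M.IsStable (selfWeight M.dimVec)

end Representations

/-! ## Virtual Poincaré polynomials

The virtual Poincaré polynomial of a complex variety `X` is
`P(X; y) = ∑_{i, k} (-1)^i dim Gr^W_k H^i_c(X, ℚ) y^k`; it is additive for decompositions into
locally closed pieces and equals `∑_i dim H^i(X, ℚ) (-y)^i` for `X` smooth and projective.
It is defined here for constructible subsets `X` of complex affine spaces (which contain all
varieties used below). By the Grothendieck-Lefschetz trace formula and Deligne's theory of weights,
the reductions of `X` modulo a general prime have point counts `#X(𝔽_{q^n}) = ∑_j m_j α_j^n`
with `m_j = ± 1`, where `α_j` runs over the Frobenius eigenvalues on `H^i_c` (with sign `(-1)^i`),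
and the part of `H^i_c` of weight `k` contributes the eigenvalues with `|α_j|² = q^k`.
So `P(X; y) = ∑_j m_j y^{k_j}`, which is what we take as the definition. -/

section VirtualPoincare

universe u v w

/-- Equations and inequations over `R` for a constructible set: the pair `(E, h)` stands for the
locus where all `g ∈ E` vanish and `h` does not, and the list stands for the union of these loci. -/
abbrev ConstructibleDatum (R : Type u) [CommRing R] (ι : Type v) :=
  List (List (MvPolynomial ι R) × MvPolynomial ι R)

/-- The points of a constructible datum in an `R`-algebra `φ : R → K` that is a field. -/
def ConstructibleDatum.points {R : Type u} [CommRing R] {ι : Type v} (D : ConstructibleDatum R ι)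
    {K : Type w} [Field K] (φ : R →+* K) : Set (ι → K) :=
  {x | ∃ c ∈ D, (∀ g ∈ c.1, MvPolynomial.eval₂ φ x g = 0) ∧ MvPolynomial.eval₂ φ x c.2 ≠ 0}

/-- `p = ∑_j m_j y^{k_j}`, where the reduction of `D` along `φ : R → F` (with `F` a field of
`q` elements) has `∑_j m_j α_j^n` points in the extensions of `F` of degree `n`, and
`|α_j|² = q^{k_j}`. -/
def IsFrobeniusWeightPolynomial {R : Type u} [CommRing R] {ι : Type v}
    (D : ConstructibleDatum R ι) {F : Type} [Field F] (φ : R →+* F) (p : Polynomial ℤ) : Prop :=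
  ∃ (r : ℕ) (m : Fin r → ℤ) (α : Fin r → ℂ) (k : Fin r → ℕ),
    (∀ j, ‖α j‖ ^ 2 = (Nat.card F : ℝ) ^ k j) ∧
    (∀ (E : Type) [Field E] [Finite E] [Algebra F E],
      (Nat.card (D.points ((algebraMap F E).comp φ)) : ℂ) =
        ∑ j, (m j : ℂ) * α j ^ Module.finrank F E) ∧
    p = ∑ j, C (m j) * X ^ k j

/-- `p` is the virtual Poincaré polynomial of `S ⊆ ℂ^ι`: for some model of `S` over a finitely
generated subring `R` of `ℂ`, the reductions of the model along all homomorphisms from `R` to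
finite fields have Frobenius weights given by `p`. -/
def IsVirtualPoincare {ι : Type v} (S : Set (ι → ℂ)) (p : Polynomial ℤ) : Prop :=
  ∃ R : Subalgebra ℤ ℂ, R.FG ∧ ∃ D : ConstructibleDatum R ι,
    D.points (algebraMap R ℂ) = S ∧
    ∀ (F : Type) [Field F] [Finite F] (φ : R →+* F), IsFrobeniusWeightPolynomial D φ p

open Classical in
/-- The virtual Poincaré polynomial of a constructible set `S ⊆ ℂ^ι`. -/
def virtualPoincare {ι : Type v} (S : Set (ι → ℂ)) : Polynomial ℤ :=
  if h : ∃ p, IsVirtualPoincare S p then h.choose else 0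

/-- The variable `y` of the field `ℚ(y)`. -/
def yVar : RatFunc ℚ := RatFunc.X

/-- The virtual Poincaré polynomial `P(S; y)` as an element of `ℚ(y)`. -/
def vP {ι : Type v} (S : Set (ι → ℂ)) : RatFunc ℚ := Polynomial.aeval yVar (virtualPoincare S)

/-- The variety `GL_n` as a subset of the affine space of matrices. -/
def GLSet (n : ℕ) : Set (Fin n × Fin n → ℂ) :=
  {g | (Matrix.of fun r c => g (r, c)).det ≠ 0}

end VirtualPoincare

/-! ## Plethystic exponential -/

section Plethysm

universe u

variable {σ : Type u}

/-- The Adams operation `f(y) ↦ f(y^m)` on `ℚ(y)`, for `m ≥ 1`. -/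
def adams (m : ℕ) (f : RatFunc ℚ) : RatFunc ℚ :=
  RatFunc.eval (algebraMap ℚ (RatFunc ℚ)) (yVar ^ m) f

open Classical in
/-- The series `∑_{m ≥ 1} (1/m) f(y^m, x^m)` for `f` without constant term: the coefficient at `n`
is the sum over all `m ≥ 1` dividing `n` of `(1/m) f_{n/m}(y^m)`. -/
def adamsSum (f : MvPowerSeries σ (RatFunc ℚ)) : MvPowerSeries σ (RatFunc ℚ) :=
  fun n => ∑ m ∈ (Finset.Icc 1 n.degree).filter (fun m => ∀ i, m ∣ n i),
    ((m : RatFunc ℚ))⁻¹ * adams m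
      (MvPowerSeries.coeff (n.mapRange (fun k => k / m) (Nat.zero_div m)) f)

/-- The plethystic exponential `Exp(f) = exp(∑_{m ≥ 1} (1/m) f(y^m, x^m))`, for `f` without
constant term. -/
def plethysticExp (f : MvPowerSeries σ (RatFunc ℚ)) : MvPowerSeries σ (RatFunc ℚ) :=
  (PowerSeries.exp (RatFunc ℚ)).subst (adamsSum f)

end Plethysm

/-! ## Stacky, integer and attractor invariants -/

section Invariants

universe u v

variable {V : Type u} [Quiver.{v} V] [Fintype V] [DecidableEq V] [∀ i j : V, Fintype (i ⟶ j)]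

/-- The locus `R^θ(Q, d) ⊆ R(Q, d)` of `θ`-semistable representations. -/
def semistableLocus (θ : V → ℝ) (d : V → ℕ) : Set (RepCoord d → ℂ) :=
  {ρ | (repOfPoint d ρ).IsSemistable θ}

/-- The group `G_d = ∏_i GL_{d_i}`, as a subset of a product of affine spaces of matrices. -/
def gaugeGroup (d : V → ℕ) : Set ((Σ i : V, Fin (d i) × Fin (d i)) → ℂ) :=
  {g | ∀ i, (Matrix.of fun r c => g ⟨i, r, c⟩).det ≠ 0}

/-- The stacky invariant `𝒜_θ(d, y) = (-y)^{χ_Q(d, d)} P(R^θ(Q, d)) / P(G_d)`. -/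
def stackyInvariant (θ : V → ℝ) (d : V → ℕ) : RatFunc ℚ :=
  (-yVar) ^ eulerForm (fun i => (d i : ℤ)) (fun i => (d i : ℤ)) *
    (vP (semistableLocus θ d) / vP (gaugeGroup d))

open Classical in
/-- The generating series `𝒜_θ(x) = ∑_{θ(d) = 0} 𝒜_θ(d, y) x^d`. -/
def stackySeries (θ : V → ℝ) : MvPowerSeries V (RatFunc ℚ) :=
  fun n => if weightPairing θ n = 0 then stackyInvariant θ n else 0

/-- A weight is generic if its kernel in `ℤ^{Q_0}` has rank one. -/
def IsGenericWeight (θ : V → ℝ) : Prop :=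
  Module.finrank ℤ (LinearMap.ker (Fintype.linearCombination ℤ θ)) = 1

open Classical in
/-- `Ω` is a family of integer DT invariants for `θ`:
`∑_{θ(d) = 0} 𝒜_θ(d, y) x^d = Exp (∑_{θ(d) = 0, d ≠ 0} Ω(d, y) x^d / (y⁻¹ - y))`. -/
def IsIntegerDTFamily (θ : V → ℝ) (Ω : (V → ℕ) → RatFunc ℚ) : Prop :=
  stackySeries θ = plethysticExp (fun n : V →₀ ℕ =>
    if weightPairing θ n = 0 ∧ n ≠ 0 then Ω n / (yVar⁻¹ - yVar) else 0)

/-- The integer DT invariant `Ω_θ(d, y)` exists, is unique, and equals `ω`. -/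
def HasIntegerDT (θ : V → ℝ) (d : V → ℕ) (ω : RatFunc ℚ) : Prop :=
  (∃ Ω, IsIntegerDTFamily θ Ω) ∧ ∀ Ω, IsIntegerDTFamily θ Ω → Ω d = ω

/-- The generic weights in `d^⊥`. -/
def genericWeights (d : V → ℕ) : Set (V → ℝ) :=
  {θ | weightPairing θ d = 0 ∧ IsGenericWeight θ}

/-- The attractor invariant `Ω_*(d, y)` equals `ω`: there are generic weights in `d^⊥` arbitrarily
close to the self-stability weight `⟨-, d⟩`, and `Ω_θ(d, y) = ω` for all of them that are
sufficiently close. -/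
def HasAttractorInvariant (d : V → ℕ) (ω : RatFunc ℚ) : Prop :=
  (𝓝[genericWeights d] selfWeight d).NeBot ∧
    ∀ᶠ θ in 𝓝[genericWeights d] selfWeight d, HasIntegerDT θ d ω

end Invariants

end

end QuiverDT

open QuiverDT

universe u v w

namespace QuiverDT

/-! Everything rests on a sink `i` of the support of a dimension vector `d`. Any subspace at `i` is
a subrepresentation, and the weight `⟨-, d⟩` at `i` is the number of arrows into `i` weighted by
`d`, hence nonnegative. A line at `i` therefore contradicts self-stability unless it is the whole
representation (`isSelfStable_iff`).

If the support has at least two vertices, every generic `θ ∈ d^⊥` near `⟨-, d⟩` is positive at some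
sink of the support (`eventually_exists_sink_pos`). Genericity gives all nonzero dimension vectors
in `θ^⊥` the same support, so the space at that sink destabilizes all of them. The stacky series is
then `1 = Exp(0)`, and all invariants vanish.

If `d = n e_i`, then `θ_i = 0`, and by genericity only multiples of `e_i` contribute. Their
representation spaces are points, so the stacky series is the quantum dilogarithm `∑ (-y)^{n²} /
P(GL_n) x^n`. A `q`-difference equation identifies its logarithm (`exp_subst_glLog`), giving `Exp(x
/ (y⁻¹ - y))`. Injectivity of `Exp` makes the invariants unique, and a Baire argument supplies
generic weights near `⟨-, d⟩`.

Virtual Poincaré polynomials are defined by a choice, so their values can be used only once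
uniqueness is known. Two models of a set agree after reduction over a larger finitely generated
ring, by the Nullstellensatz, and point counts determine the weight polynomial. -/

/-! ### Reduction to finite fields and uniqueness of the virtual Poincaré polynomial -/

instance isJacobsonRing_int : IsJacobsonRing ℤ := by
  rw [isJacobsonRing_iff_prime_eq]
  intro P hP
  by_cases h : P = ⊥
  · subst h
    refine le_antisymm (fun x hx => ?_) Ideal.le_jacobson
    rw [Ideal.mem_jacobson_bot] at hx
    -- Testing the radical with the multiplier `x` itself makes `x² + 1` a unit, that is `±1`.
    rcases Int.isUnit_iff.1 (hx x) with h | h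
    · simpa using h
    · nlinarith [mul_self_nonneg x]
  · have := hP.isMaximal h
    exact Ideal.jacobson_eq_self_of_isMaximal

/-- A nontrivial finitely generated commutative ring has a homomorphism to a finite field. -/
theorem exists_ringHom_finite_field (R : Type) [CommRing R] [Nontrivial R]
    [Algebra.FiniteType ℤ R] :
    ∃ (F : Type) (_ : Field F), Finite F ∧ Nonempty (R →+* F) := by
  obtain ⟨m, hm⟩ := Ideal.exists_maximal R
  let : Field (R ⧸ m) := Ideal.Quotient.field m
  refine ⟨R ⧸ m, inferInstance, ?_, ⟨Ideal.Quotient.mk m⟩⟩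
  have : Algebra.FiniteType ℤ (R ⧸ m) :=
    Algebra.FiniteType.of_surjective (Ideal.Quotient.mkₐ ℤ m) (Ideal.Quotient.mkₐ_surjective ℤ m)
  -- Nullstellensatz over the Jacobson ring `ℤ`. Characteristic zero is then impossible: `ℤ` would
  -- embed in a field integral over it and so be a field.
  have hfin : Module.Finite ℤ (R ⧸ m) := finite_of_finite_type_of_isJacobsonRing ℤ (R ⧸ m)
  obtain ⟨p, hp⟩ := CharP.exists (R ⧸ m)
  rcases CharP.char_is_prime_or_zero (R ⧸ m) p with h | rfl
  · have := Fact.mk h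
    let := ZMod.algebra (R ⧸ m) p
    have : Module.Finite (ZMod p) (R ⧸ m) := Module.Finite.of_restrictScalars_finite ℤ (ZMod p) _
    exact Module.finite_of_finite (ZMod p)
  · have := CharP.charP_to_charZero (R ⧸ m)
    have hinj : Function.Injective (algebraMap ℤ (R ⧸ m)) := by
      intro a b hab
      simpa using hab
    exact absurd (isField_of_isIntegral_of_isField hinj (Field.toIsField (R ⧸ m)))
      Int.not_isField

namespace ConstructibleDatum

variable {R : Type u} [CommRing R] {ι : Type v}

/-- Base change of a constructible datum. -/
noncomputable def baseChange {S : Type*} [CommRing S] (f : R →+* S) (D : ConstructibleDatum R ι) :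
    ConstructibleDatum S ι :=
  D.map fun c => (c.1.map (MvPolynomial.map f), MvPolynomial.map f c.2)

theorem points_baseChange {S : Type*} [CommRing S] (f : R →+* S) (D : ConstructibleDatum R ι)
    {K : Type w} [Field K] (φ : S →+* K) :
    (D.baseChange f).points φ = D.points (φ.comp f) := by
  ext x
  simp only [points, baseChange, List.mem_map, Set.mem_ofPred_eq]
  constructor
  · rintro ⟨_, ⟨c, hc, rfl⟩, h1, h2⟩
    refine ⟨c, hc, fun g hg => ?_, ?_⟩
    · rw [← MvPolynomial.eval₂_map]
      exact h1 _ (List.mem_map_of_mem hg)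
    · simpa [MvPolynomial.eval₂_map] using h2
  · rintro ⟨c, hc, h1, h2⟩
    refine ⟨_, ⟨c, hc, rfl⟩, fun g hg => ?_, ?_⟩
    · obtain ⟨g', hg', rfl⟩ := List.mem_map.1 hg
      simpa [MvPolynomial.eval₂_map] using h1 g' hg'
    · simpa [MvPolynomial.eval₂_map] using h2

theorem mem_points_cons {c : List (MvPolynomial ι R) × MvPolynomial ι R}
    {D : ConstructibleDatum R ι} {K : Type w} [Field K] {φ : R →+* K} {x : ι → K} :
    x ∈ points (c :: D) φ ↔
      ((∀ g ∈ c.1, MvPolynomial.eval₂ φ x g = 0) ∧ MvPolynomial.eval₂ φ x c.2 ≠ 0) ∨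
        x ∈ D.points φ := by
  simp [points]

theorem notMem_points_nil {K : Type w} [Field K] {φ : R →+* K} {x : ι → K} :
    x ∉ points ([] : ConstructibleDatum R ι) φ := by
  simp [points]

end ConstructibleDatum

open ConstructibleDatum

/-- If a locally closed set has no complex points, neither has any reduction over a large enough
ring of coefficients. -/
theorem exists_coefficients_of_isEmpty {ι : Type v} [Finite ι] (R : Subalgebra ℤ ℂ)
    (E : List (MvPolynomial ι R)) (h : MvPolynomial ι R)
    (hE : ∀ x : ι → ℂ, (∀ g ∈ E, MvPolynomial.eval₂ (algebraMap R ℂ) x g = 0) →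
      MvPolynomial.eval₂ (algebraMap R ℂ) x h = 0) :
    ∃ T : Finset ℂ, ∀ (R' : Subalgebra ℤ ℂ) (hle : R ≤ R'), (T : Set ℂ) ⊆ R' →
      ∀ {K : Type} [Field K] (φ : R' →+* K) (x : ι → K),
        (∀ g ∈ E, MvPolynomial.eval₂ (φ.comp (Subalgebra.inclusion hle).toRingHom) x g = 0) →
        MvPolynomial.eval₂ (φ.comp (Subalgebra.inclusion hle).toRingHom) x h = 0 := by
  classical
  let v : Fin E.length → MvPolynomial ι ℂ := fun i => MvPolynomial.map (algebraMap R ℂ) (E.get i)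
  -- By the Nullstellensatz emptiness has an algebraic certificate `h ^ N = ∑ c_i E_i`. Once `R'`
  -- contains the coefficients of the `c_i`, the identity holds over `R'` and survives every
  -- homomorphism to a field.
  have hmem : MvPolynomial.map (algebraMap R ℂ) h ∈ (Ideal.span (Set.range v)).radical := by
    rw [← MvPolynomial.vanishingIdeal_zeroLocus_eq_radical (K := ℂ), MvPolynomial.zeroLocus_span]
    intro x hx
    rw [MvPolynomial.aeval_def, MvPolynomial.eval₂_map]
    refine hE x fun g hg => ?_
    obtain ⟨i, rfl⟩ := List.get_of_mem hg
    have := hx (v i) ⟨i, rfl⟩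
    rwa [MvPolynomial.aeval_def, MvPolynomial.eval₂_map] at this
  obtain ⟨N, hN⟩ := hmem
  obtain ⟨c, hc⟩ := Ideal.mem_span_range_iff_exists_fun.1 hN
  refine ⟨Finset.univ.biUnion fun i => (c i).coeffs, fun R' hle hT K _ φ x hx => ?_⟩
  set j := (Subalgebra.inclusion hle).toRingHom with hj
  have hcj : (algebraMap R' ℂ).comp j = algebraMap R ℂ := rfl
  have hlift : ∀ i, ∃ c' : MvPolynomial ι R', MvPolynomial.map (algebraMap R' ℂ) c' = c i := by
    intro i
    have : c i ∈ Set.range (MvPolynomial.map (σ := ι) (algebraMap R' ℂ)) := by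
      rw [MvPolynomial.mem_range_map_iff_coeffs_subset]
      intro a ha
      exact ⟨⟨a, hT (by simpa using ⟨i, ha⟩)⟩, rfl⟩
    exact this
  choose c' hc' using hlift
  have key : ∑ i, c' i * MvPolynomial.map j (E.get i) = MvPolynomial.map j h ^ N := by
    apply MvPolynomial.map_injective (algebraMap R' ℂ) Subtype.val_injective
    simp only [map_sum, map_mul, map_pow, MvPolynomial.map_map, hcj, hc']
    exact hc
  have key2 := congrArg (MvPolynomial.eval₂Hom φ x) key
  simp only [map_sum, map_mul, map_pow, MvPolynomial.coe_eval₂Hom, MvPolynomial.eval₂_map] at key2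
  rw [Finset.sum_eq_zero fun i _ => by rw [hx _ (List.get_mem E i), mul_zero]] at key2
  exact eq_zero_of_pow_eq_zero key2.symm

/-- Induction on `D`, cutting the piece `(E, h)` along the head `(E', h')`. Outside the head either
`h' = 0`, an extra equation, or some `g ∈ E'` is nonzero, which replaces `h` by `h * g`. Each case
is again a single piece, now contained in the tail; hence `c` is quantified inside the induction. -/
theorem exists_coefficients_of_subset {ι : Type v} [Finite ι] (R : Subalgebra ℤ ℂ)
    (D : ConstructibleDatum R ι) :
    ∀ c : List (MvPolynomial ι R) × MvPolynomial ι R,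
    points [c] (algebraMap R ℂ) ⊆ D.points (algebraMap R ℂ) →
    ∃ T : Finset ℂ, ∀ (R' : Subalgebra ℤ ℂ) (hle : R ≤ R'), (T : Set ℂ) ⊆ R' →
      ∀ {K : Type} [Field K] (φ : R' →+* K),
        points [c] (φ.comp (Subalgebra.inclusion hle).toRingHom) ⊆
          D.points (φ.comp (Subalgebra.inclusion hle).toRingHom) := by
  classical
  induction D with
  | nil =>
    rintro ⟨E, h⟩ hc
    obtain ⟨T, hT⟩ := exists_coefficients_of_isEmpty R E h fun x hx => by
      by_contra hne
      exact notMem_points_nil (hc (mem_points_cons.2 (Or.inl ⟨hx, hne⟩)))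
    refine ⟨T, fun R' hle hTR K _ φ x hx => ?_⟩
    rcases mem_points_cons.1 hx with hx | hx
    · exact absurd (hT R' hle hTR φ x hx.1) hx.2
    · exact hx
  | cons c' D ih =>
    rintro ⟨E, h⟩ hc
    obtain ⟨E', h'⟩ := c'
    obtain ⟨T₀, hT₀⟩ := ih (h' :: E, h) fun x hx => by
      rcases mem_points_cons.1 hx with hx | hx
      · rcases mem_points_cons.1 (hc (mem_points_cons.2
          (Or.inl ⟨fun g hg => hx.1 g (List.mem_cons_of_mem _ hg), hx.2⟩))) with hy | hy
        · exact absurd (hx.1 h' List.mem_cons_self) hy.2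
        · exact hy
      · exact absurd hx notMem_points_nil
    have h1 : ∀ i : Fin E'.length, ∃ T : Finset ℂ, ∀ (R' : Subalgebra ℤ ℂ) (hle : R ≤ R'),
        (T : Set ℂ) ⊆ R' → ∀ {K : Type} [Field K] (φ : R' →+* K),
        points [(E, h * E'.get i)] (φ.comp (Subalgebra.inclusion hle).toRingHom) ⊆
          points D (φ.comp (Subalgebra.inclusion hle).toRingHom) := by
      intro i
      refine ih (E, h * E'.get i) fun x hx => ?_
      rcases mem_points_cons.1 hx with hx | hx
      · have hne := hx.2
        simp only [MvPolynomial.eval₂_mul] at hne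
        rcases mem_points_cons.1 (hc (mem_points_cons.2
          (Or.inl ⟨hx.1, left_ne_zero_of_mul hne⟩))) with hy | hy
        · exact absurd (hy.1 _ (List.get_mem E' i)) (right_ne_zero_of_mul hne)
        · exact hy
      · exact absurd hx notMem_points_nil
    choose T hT using h1
    refine ⟨T₀ ∪ Finset.univ.biUnion T, fun R' hle hTR K _ φ x hx => ?_⟩
    rw [Finset.coe_union, Set.union_subset_iff] at hTR
    rcases mem_points_cons.1 hx with hx | hx
    · rw [mem_points_cons]
      by_cases h0 : MvPolynomial.eval₂ (φ.comp (Subalgebra.inclusion hle).toRingHom) x h' = 0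
      · refine Or.inr (hT₀ R' hle hTR.1 φ (mem_points_cons.2 (Or.inl ⟨fun g hg => ?_, hx.2⟩)))
        rcases List.mem_cons.1 hg with rfl | hg
        · exact h0
        · exact hx.1 g hg
      · by_cases hall : ∀ g ∈ E',
            MvPolynomial.eval₂ (φ.comp (Subalgebra.inclusion hle).toRingHom) x g = 0
        · exact Or.inl ⟨hall, h0⟩
        · push Not at hall
          obtain ⟨g, hg, hne⟩ := hall
          obtain ⟨i, rfl⟩ := List.get_of_mem hg
          refine Or.inr (hT i R' hle (fun a ha => hTR.2 ?_) φ
            (mem_points_cons.2 (Or.inl ⟨hx.1, ?_⟩)))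
          · simpa using ⟨i, ha⟩
          · simpa only [MvPolynomial.eval₂_mul] using mul_ne_zero hx.2 hne
    · exact absurd hx notMem_points_nil

/-- Inclusions of constructible sets over `ℂ` persist under reduction, over a large enough ring of
coefficients. -/
theorem exists_coefficients_of_points_subset {ι : Type v} [Finite ι] (R : Subalgebra ℤ ℂ)
    (D D' : ConstructibleDatum R ι) (hD : D.points (algebraMap R ℂ) ⊆ D'.points (algebraMap R ℂ)) :
    ∃ T : Finset ℂ, ∀ (R' : Subalgebra ℤ ℂ) (hle : R ≤ R'), (T : Set ℂ) ⊆ R' →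
      ∀ {K : Type} [Field K] (φ : R' →+* K),
        D.points (φ.comp (Subalgebra.inclusion hle).toRingHom) ⊆
          D'.points (φ.comp (Subalgebra.inclusion hle).toRingHom) := by
  classical
  induction D with
  | nil => exact ⟨∅, fun R' hle _ K _ φ x hx => absurd hx notMem_points_nil⟩
  | cons c D ih =>
    obtain ⟨T₁, hT₁⟩ := ih fun x hx => hD (mem_points_cons.2 (Or.inr hx))
    obtain ⟨T₂, hT₂⟩ := exists_coefficients_of_subset R D' c fun x hx => by
      rcases mem_points_cons.1 hx with hx | hx
      · exact hD (mem_points_cons.2 (Or.inl hx))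
      · exact absurd hx notMem_points_nil
    refine ⟨T₁ ∪ T₂, fun R' hle hTR K _ φ x hx => ?_⟩
    rw [Finset.coe_union, Set.union_subset_iff] at hTR
    rcases mem_points_cons.1 hx with hx | hx
    · exact hT₂ R' hle hTR.2 φ (mem_points_cons.2 (Or.inl hx))
    · exact hT₁ R' hle hTR.1 φ hx

/-- Distinct nonzero `α` give linearly independent sequences `α ^ n`, so multiplicities cancel on
each fibre of `α`; the absolute value of `α` fixes `k` on the fibre. -/
theorem sum_C_mul_X_pow_eq_zero {κ : Type*} [Fintype κ] {q : ℕ} (hq : 2 ≤ q) (m : κ → ℤ)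
    (α : κ → ℂ) (k : κ → ℕ) (hα : ∀ j, ‖α j‖ ^ 2 = (q : ℝ) ^ k j)
    (hsum : ∀ n : ℕ, n ≠ 0 → ∑ j, (m j : ℂ) * α j ^ n = 0) :
    ∑ j, C (m j) * X ^ k j = (0 : Polynomial ℤ) := by
  classical
  have hq0 : (0 : ℝ) < q := by positivity
  -- The power sums are known to vanish only for `n ≥ 1`, hence the factor `X`; it costs nothing
  -- because no `α j` is zero.
  have hpoly : ∀ P : Polynomial ℂ, ∑ j, (m j : ℂ) * (X * P).eval (α j) = 0 := by
    intro P
    simp_rw [Polynomial.eval_mul, Polynomial.eval_X, Polynomial.eval_eq_sum_range, Finset.mul_sum]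
    rw [Finset.sum_comm]
    refine Finset.sum_eq_zero fun i _ => ?_
    rw [← mul_zero (P.coeff i), ← hsum (i + 1) i.succ_ne_zero, Finset.mul_sum]
    refine Finset.sum_congr rfl fun j _ => ?_
    ring
  have hfib : ∀ j₀, ∑ j with α j = α j₀, m j = 0 := by
    intro j₀
    -- This polynomial vanishes at every value of `α` except `α j₀`.
    let P : Polynomial ℂ := ∏ b ∈ (Finset.univ.image α).erase (α j₀), (X - C b)
    have h1 := hpoly P
    rw [← Finset.sum_filter_add_sum_filter_not _ (fun j => α j = α j₀)] at h1
    rw [Finset.sum_eq_zero (s := Finset.univ.filter fun j => ¬ α j = α j₀), add_zero] at h1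
    · rw [Finset.sum_congr rfl (g := fun j => (m j : ℂ) * (X * P).eval (α j₀)) fun j hj => by
        rw [(Finset.mem_filter.1 hj).2], ← Finset.sum_mul] at h1
      have hne : (X * P).eval (α j₀) ≠ 0 := by
        rw [Polynomial.eval_mul, Polynomial.eval_X, Polynomial.eval_prod]
        refine mul_ne_zero (fun h0 => ?_) (Finset.prod_ne_zero_iff.2 fun b hb => ?_)
        · have := hα j₀
          rw [h0, norm_zero, zero_pow two_ne_zero] at this
          exact (pow_pos hq0 _).ne this
        · simpa [sub_eq_zero] using (Finset.ne_of_mem_erase hb).symm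
      exact_mod_cast (mul_eq_zero.1 h1).resolve_right hne
    · intro j hj
      have : (∏ b ∈ (Finset.univ.image α).erase (α j₀), (X - C b)).eval (α j) = 0 := by
        rw [Polynomial.eval_prod]
        refine Finset.prod_eq_zero (i := α j) ?_ (by simp)
        simpa using (Finset.mem_filter.1 hj).2
      rw [Polynomial.eval_mul, this, mul_zero, mul_zero]
  have hk : ∀ j j', α j = α j' → k j = k j' := by
    intro j j' h
    have h2 := (hα j).symm.trans ((congrArg (fun z => ‖z‖ ^ 2) h).trans (hα j'))
    exact Nat.pow_right_injective hq (by exact_mod_cast h2)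
  rw [← Finset.sum_fiberwise_of_maps_to (s := Finset.univ) (t := Finset.univ.image α) (g := α)
    (fun j _ => Finset.mem_image_of_mem α (Finset.mem_univ j))]
  refine Finset.sum_eq_zero fun a ha => ?_
  obtain ⟨j₀, -, rfl⟩ := Finset.mem_image.1 ha
  rw [Finset.sum_congr rfl (g := fun j => C (m j) * (X : Polynomial ℤ) ^ k j₀) fun j hj => by
    rw [hk j j₀ (Finset.mem_filter.1 hj).2], ← Finset.sum_mul, ← map_sum, hfib, map_zero, zero_mul]

theorem exists_extension_finrank (F : Type) [Field F] [Finite F] (n : ℕ) (hn : n ≠ 0) :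
    ∃ (E : Type) (_ : Field E) (_ : Finite E) (_ : Algebra F E), Module.finrank F E = n := by
  obtain ⟨p, hp⟩ := CharP.exists F
  have : Fact p.Prime := ⟨CharP.char_is_prime F p⟩
  have : NeZero n := ⟨hn⟩
  exact ⟨FiniteField.Extension F p n, inferInstance, inferInstance, inferInstance,
    FiniteField.finrank_extension F p n⟩

theorem IsFrobeniusWeightPolynomial.unique {R R' : Type*} [CommRing R] [CommRing R'] {ι : Type v}
    {D : ConstructibleDatum R ι} {D' : ConstructibleDatum R' ι} {F : Type} [Field F] [Finite F]
    {φ : R →+* F} {φ' : R' →+* F} {p p' : Polynomial ℤ}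
    (h : IsFrobeniusWeightPolynomial D φ p) (h' : IsFrobeniusWeightPolynomial D' φ' p')
    (hpoints : ∀ (E : Type) [Field E] [Finite E] [Algebra F E],
      D.points ((algebraMap F E).comp φ) = D'.points ((algebraMap F E).comp φ')) : p = p' := by
  obtain ⟨r, m, α, k, hα, hc, rfl⟩ := h
  obtain ⟨r', m', α', k', hα', hc', rfl⟩ := h'
  have := sum_C_mul_X_pow_eq_zero (κ := Fin r ⊕ Fin r') (q := Nat.card F) Finite.one_lt_card
    (Sum.elim m (-m')) (Sum.elim α α') (Sum.elim k k')
    (by rintro (j | j) <;> simp [hα, hα']) (fun n hn => by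
      obtain ⟨E, _, _, _, rfl⟩ := exists_extension_finrank F n hn
      have h1 := hc E
      rw [hpoints E, hc' E] at h1
      simp [h1])
  simpa [add_neg_eq_zero] using this

/-- Both models are moved to one finitely generated ring that also contains the coefficients
certifying the two inclusions. There their reductions have the same points, and a single residue
field is enough to compare the polynomials. -/
theorem IsVirtualPoincare.unique {ι : Type v} [Finite ι] {S : Set (ι → ℂ)} {p p' : Polynomial ℤ}
    (h : IsVirtualPoincare S p) (h' : IsVirtualPoincare S p') : p = p' := by
  obtain ⟨R₁, hR₁, D₁, hD₁, hF₁⟩ := h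
  obtain ⟨R₂, hR₂, D₂, hD₂, hF₂⟩ := h'
  set j₁ := (Subalgebra.inclusion (le_sup_left : R₁ ≤ R₁ ⊔ R₂)).toRingHom
  set j₂ := (Subalgebra.inclusion (le_sup_right : R₂ ≤ R₁ ⊔ R₂)).toRingHom
  have e₁ : (D₁.baseChange j₁).points (algebraMap (R₁ ⊔ R₂ : Subalgebra ℤ ℂ) ℂ) = S := by
    rw [points_baseChange]; exact hD₁
  have e₂ : (D₂.baseChange j₂).points (algebraMap (R₁ ⊔ R₂ : Subalgebra ℤ ℂ) ℂ) = S := by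
    rw [points_baseChange]; exact hD₂
  obtain ⟨T, hT⟩ := exists_coefficients_of_points_subset _ _ _ (e₁.trans e₂.symm).le
  obtain ⟨T', hT'⟩ := exists_coefficients_of_points_subset _ _ _ (e₂.trans e₁.symm).le
  let R : Subalgebra ℤ ℂ := (R₁ ⊔ R₂) ⊔
    (Algebra.adjoin ℤ (T : Set ℂ) ⊔ Algebra.adjoin ℤ (T' : Set ℂ))
  have hR : R.FG := (hR₁.sup hR₂).sup ((Subalgebra.fg_adjoin_finset T).sup
    (Subalgebra.fg_adjoin_finset T'))
  have hle : R₁ ⊔ R₂ ≤ R := le_sup_left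
  have hTR : (T : Set ℂ) ⊆ R :=
    Algebra.subset_adjoin.trans (SetLike.coe_subset_coe.2 (le_sup_left.trans le_sup_right))
  have hTR' : (T' : Set ℂ) ⊆ R :=
    Algebra.subset_adjoin.trans (SetLike.coe_subset_coe.2 (le_sup_right.trans le_sup_right))
  have : Algebra.FiniteType ℤ R := R.fg_iff_finiteType.1 hR
  obtain ⟨F, _, _, ⟨φ⟩⟩ := exists_ringHom_finite_field R
  set j := (Subalgebra.inclusion hle).toRingHom
  refine (hF₁ F (φ.comp (j.comp j₁))).unique (hF₂ F (φ.comp (j.comp j₂))) fun E _ _ _ => ?_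
  have h1 := hT R hle hTR ((algebraMap F E).comp φ)
  have h2 := hT' R hle hTR' ((algebraMap F E).comp φ)
  rw [points_baseChange, points_baseChange] at h1 h2
  exact h1.antisymm h2

theorem virtualPoincare_eq {ι : Type v} [Finite ι] {S : Set (ι → ℂ)} {p : Polynomial ℤ}
    (h : IsVirtualPoincare S p) : virtualPoincare S = p := by
  have hex : ∃ p, IsVirtualPoincare S p := ⟨p, h⟩
  rw [virtualPoincare, dif_pos hex]
  exact hex.choose_spec.unique h

/-! ### Polynomial-count sets and general linear groups -/

/-- A set with a model over `ℤ` whose number of points over finite fields is a polynomial in the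
order of the field is polynomial-count: its virtual Poincaré polynomial is obtained by
substituting `y²`. -/
theorem isVirtualPoincare_of_card {ι : Type v} {S : Set (ι → ℂ)}
    (D : ConstructibleDatum (⊥ : Subalgebra ℤ ℂ) ι) (P : Polynomial ℤ)
    (hS : D.points (algebraMap (⊥ : Subalgebra ℤ ℂ) ℂ) = S)
    (hP : ∀ (E : Type) [Field E] [Finite E] (ψ : (⊥ : Subalgebra ℤ ℂ) →+* E),
      (Nat.card (D.points ψ) : ℤ) = P.eval (Nat.card E : ℤ)) :
    IsVirtualPoincare S (Polynomial.expand ℤ 2 P) := by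
  refine ⟨⊥, Subalgebra.fg_bot, D, hS, fun F _ _ φ =>
    -- The monomial of degree `j` contributes the eigenvalue `q ^ j`, whose weight is `2 * j`.
    ⟨P.natDegree + 1, fun j => P.coeff j, fun j => (Nat.card F : ℂ) ^ (j : ℕ), fun j => 2 * j,
      fun j => ?_, fun E _ _ _ => ?_, ?_⟩⟩
  · simp [← pow_mul, mul_comm]
  · have h := hP E ((algebraMap F E).comp φ)
    rw [Polynomial.eval_eq_sum_range, Module.natCard_eq_pow_finrank (K := F) (V := E)] at h
    have h' := congrArg (Int.cast : ℤ → ℂ) h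
    push_cast at h'
    rw [Fin.sum_univ_eq_sum_range fun j =>
      (P.coeff j : ℂ) * ((Nat.card F : ℂ) ^ j) ^ Module.finrank F E, h']
    refine Finset.sum_congr rfl fun j _ => ?_
    rw [← pow_mul, ← pow_mul, mul_comm j]
  · rw [Fin.sum_univ_eq_sum_range fun j => C (P.coeff j) * (X : Polynomial ℤ) ^ (2 * j)]
    conv_lhs => rw [P.as_sum_range_C_mul_X_pow]
    simp [pow_mul]

theorem vP_eq_aeval_expand {ι : Type v} [Finite ι] {S : Set (ι → ℂ)} {P : Polynomial ℤ}
    (h : IsVirtualPoincare S (Polynomial.expand ℤ 2 P)) :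
    vP S = Polynomial.aeval (yVar ^ 2) P := by
  rw [vP, virtualPoincare_eq h, Polynomial.expand_aeval]

theorem vP_empty {ι : Type v} [Finite ι] : vP (∅ : Set (ι → ℂ)) = 0 := by
  have h : IsVirtualPoincare (∅ : Set (ι → ℂ)) (Polynomial.expand ℤ 2 0) :=
    isVirtualPoincare_of_card [] 0 (by ext; simp [points]) fun E _ _ ψ => by simp [points]
  rw [vP_eq_aeval_expand h, map_zero]

theorem vP_univ {ι : Type v} [IsEmpty ι] : vP (Set.univ : Set (ι → ℂ)) = 1 := by
  have h : IsVirtualPoincare (Set.univ : Set (ι → ℂ)) (Polynomial.expand ℤ 2 1) :=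
    isVirtualPoincare_of_card [([], 1)] 1 (by ext; simp [points]) fun E _ _ ψ => by
      simp [points]
  rw [vP_eq_aeval_expand h, map_one]

/-- The polynomial `∏_{k < n} (q ^ n - q ^ k)` counting invertible matrices. -/
noncomputable def glCount (n : ℕ) : Polynomial ℤ := ∏ k ∈ Finset.range n, (X ^ n - X ^ k)

theorem natCard_GL (n : ℕ) (E : Type) [Field E] [Finite E] :
    (Nat.card (GL (Fin n) E) : ℤ) = (glCount n).eval (Nat.card E : ℤ) := by
  have := Fintype.ofFinite E
  rw [Matrix.card_GL_field, glCount, Polynomial.eval_prod, Nat.cast_prod, Nat.card_eq_fintype_card,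
    ← Fin.prod_univ_eq_prod_range fun k => Polynomial.eval (Fintype.card E : ℤ) (X ^ n - X ^ k)]
  refine Finset.prod_congr rfl fun k _ => ?_
  rw [Nat.cast_sub (Nat.pow_le_pow_right Fintype.card_pos k.2.le)]
  simp

theorem eval₂_det {R : Type*} [CommRing R] {ι : Type*} {n : ℕ} {K : Type*} [Field K] (φ : R →+* K)
    (x : ι → K) (f : Fin n → Fin n → ι) :
    MvPolynomial.eval₂ φ x (Matrix.of fun r c => (MvPolynomial.X (f r c) : MvPolynomial ι R)).det =
      (Matrix.of fun r c => x (f r c)).det := by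
  rw [← MvPolynomial.coe_eval₂Hom, RingHom.map_det]
  congr 1
  ext r c
  simp

/-- A family of invertible matrices is a point of the product of general linear groups. -/
noncomputable def piGLEquiv {V : Type*} (d : V → ℕ) (K : Type*) [Field K] :
    {x : (Σ i : V, Fin (d i) × Fin (d i)) → K //
      ∀ i, (Matrix.of fun r c => x ⟨i, r, c⟩).det ≠ 0} ≃ ∀ i, GL (Fin (d i)) K where
  toFun x i := Matrix.GeneralLinearGroup.mkOfDetNeZero _ (x.2 i)
  invFun g := ⟨fun s => (g s.1).val s.2.1 s.2.2, fun i =>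
    ((Matrix.isUnit_iff_isUnit_det _).1 (g i).isUnit).ne_zero⟩
  left_inv x := rfl
  right_inv g := by
    funext i
    apply Units.ext
    rfl

theorem vP_gaugeGroup {V : Type u} [Fintype V] (d : V → ℕ) :
    vP (gaugeGroup d) = ∏ i, Polynomial.aeval (yVar ^ 2) (glCount (d i)) := by
  have hpts : ∀ {K : Type} [Field K] (ψ : (⊥ : Subalgebra ℤ ℂ) →+* K),
      points [([], ∏ i, (Matrix.of fun r c => (MvPolynomial.X ⟨i, r, c⟩ :
        MvPolynomial (Σ i : V, Fin (d i) × Fin (d i)) (⊥ : Subalgebra ℤ ℂ))).det)] ψ =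
      {x | ∀ i, (Matrix.of fun r c => x ⟨i, r, c⟩).det ≠ 0} := by
    intro K _ ψ
    ext x
    simp only [points, List.mem_singleton, exists_eq_left, List.not_mem_nil, false_imp_iff,
      implies_true, true_and, Set.mem_ofPred_eq]
    rw [← MvPolynomial.coe_eval₂Hom, map_prod, Finset.prod_ne_zero_iff]
    simp only [MvPolynomial.coe_eval₂Hom, Finset.mem_univ, true_imp_iff]
    refine forall_congr' fun i => ?_
    rw [eval₂_det ψ x fun r c => (⟨i, r, c⟩ : Σ i : V, Fin (d i) × Fin (d i))]
  have h : IsVirtualPoincare (gaugeGroup d) (Polynomial.expand ℤ 2 (∏ i, glCount (d i))) := by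
    refine isVirtualPoincare_of_card _ _ (hpts _) fun E _ _ ψ => ?_
    rw [hpts, Polynomial.eval_prod]
    simp_rw [← natCard_GL]
    rw [← Nat.cast_prod, ← Nat.card_pi]
    exact congrArg _ (Nat.card_congr (piGLEquiv d E))
  rw [vP_eq_aeval_expand h, map_prod]

theorem vP_GLSet (n : ℕ) : vP (GLSet n) = Polynomial.aeval (yVar ^ 2) (glCount n) := by
  have hpts : ∀ {K : Type} [Field K] (ψ : (⊥ : Subalgebra ℤ ℂ) →+* K),
      points [([], (Matrix.of fun r c => (MvPolynomial.X (r, c) :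
        MvPolynomial (Fin n × Fin n) (⊥ : Subalgebra ℤ ℂ))).det)] ψ =
      {x | (Matrix.of fun r c => x (r, c)).det ≠ 0} := by
    intro K _ ψ
    ext x
    simp only [points, List.mem_singleton, exists_eq_left, List.not_mem_nil, false_imp_iff,
      implies_true, true_and, Set.mem_ofPred_eq]
    rw [eval₂_det ψ x fun r c => (r, c)]
  have h : IsVirtualPoincare (GLSet n) (Polynomial.expand ℤ 2 (glCount n)) := by
    refine isVirtualPoincare_of_card _ _ (hpts _) fun E _ _ ψ => ?_
    rw [hpts, ← natCard_GL]
    refine congrArg _ (Nat.card_congr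
      ⟨fun x => Matrix.GeneralLinearGroup.mkOfDetNeZero _ x.2,
        fun g => ⟨fun s => g.val s.1 s.2,
          ((Matrix.isUnit_iff_isUnit_det _).1 g.isUnit).ne_zero⟩, fun x => rfl, fun g => ?_⟩)
    apply Units.ext
    rfl
  rw [vP_eq_aeval_expand h]

/-! ### Adams operations on `ℚ(y)` -/

theorem yVar_ne_zero : yVar ≠ 0 := RatFunc.X_ne_zero

theorem yVar_pow_eq_algebraMap (n : ℕ) :
    yVar ^ n = algebraMap (Polynomial ℚ) (RatFunc ℚ) (X ^ n) := by
  rw [map_pow, RatFunc.algebraMap_X, yVar]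

theorem yVar_pow_injective : Function.Injective fun n : ℕ => yVar ^ n := by
  intro a b h
  simp only [yVar_pow_eq_algebraMap] at h
  simpa using congrArg Polynomial.natDegree (RatFunc.algebraMap_injective ℚ h)

theorem one_sub_yVar_pow_ne_zero {n : ℕ} (hn : n ≠ 0) : 1 - yVar ^ n ≠ 0 := fun h =>
  hn (yVar_pow_injective (by simpa using (sub_eq_zero.1 h).symm))

theorem inv_sub_yVar_pow_ne_zero {n : ℕ} (hn : n ≠ 0) : (yVar ^ n)⁻¹ - yVar ^ n ≠ 0 := by
  have h0 : yVar ^ n ≠ 0 := pow_ne_zero n yVar_ne_zero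
  rw [inv_eq_one_div, div_sub' h0, ← pow_two, ← pow_mul]
  exact div_ne_zero (one_sub_yVar_pow_ne_zero (mul_ne_zero hn two_ne_zero)) h0

theorem adams_zero (m : ℕ) : adams m 0 = 0 := RatFunc.eval_zero _ _

theorem adams_one (f : RatFunc ℚ) : adams 1 f = f := by
  have h : ∀ p : Polynomial ℚ, p.eval₂ (algebraMap ℚ (RatFunc ℚ)) (yVar ^ 1) =
      algebraMap (Polynomial ℚ) (RatFunc ℚ) p := fun p => by
    rw [pow_one, yVar]
    refine Eq.trans ?_ (RatFunc.aeval_X_left_eq_algebraMap p)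
    exact congrArg (fun g => Polynomial.eval₂ g RatFunc.X p) (Subsingleton.elim _ _)
  rw [adams, RatFunc.eval, h, h, RatFunc.num_div_denom]

/-- `RatFunc.eval` uses the reduced fraction. Its denominator divides `q`, so it does not vanish at
`y ^ m` either, and cross-multiplication applies. -/
theorem adams_div (m : ℕ) (p q : Polynomial ℚ)
    (hq : q.eval₂ (algebraMap ℚ (RatFunc ℚ)) (yVar ^ m) ≠ 0) :
    adams m (algebraMap _ _ p / algebraMap _ _ q) =
      p.eval₂ (algebraMap ℚ (RatFunc ℚ)) (yVar ^ m) /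
        q.eval₂ (algebraMap ℚ (RatFunc ℚ)) (yVar ^ m) := by
  have hq0 : q ≠ 0 := by rintro rfl; simp at hq
  set x : RatFunc ℚ := algebraMap _ _ p / algebraMap _ _ q with hx
  have h1 := congrArg (Polynomial.eval₂ (algebraMap ℚ (RatFunc ℚ)) (yVar ^ m))
    ((RatFunc.num_mul_eq_mul_denom_iff hq0).2 hx)
  have hd : x.denom.eval₂ (algebraMap ℚ (RatFunc ℚ)) (yVar ^ m) ≠ 0 := by
    obtain ⟨s, hs⟩ := RatFunc.denom_div_dvd p q
    intro h
    rw [hs, Polynomial.eval₂_mul] at hq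
    exact hq (by rw [← hx, h, zero_mul])
  rw [Polynomial.eval₂_mul, Polynomial.eval₂_mul] at h1
  rw [adams, RatFunc.eval, div_eq_div_iff hd hq, h1]

theorem adams_inv_sub {m : ℕ} (hm : m ≠ 0) :
    adams m (yVar⁻¹ - yVar)⁻¹ = ((yVar ^ m)⁻¹ - yVar ^ m)⁻¹ := by
  have h0 : ∀ n : ℕ, yVar ^ n ≠ 0 := fun n => pow_ne_zero n yVar_ne_zero
  have key : ∀ t : RatFunc ℚ, t ≠ 0 → (t⁻¹ - t)⁻¹ = t / (1 - t ^ 2) := fun t ht => by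
    rw [inv_eq_one_div t, div_sub' ht, inv_div, pow_two]
  have e : (yVar⁻¹ - yVar)⁻¹ = algebraMap (Polynomial ℚ) (RatFunc ℚ) X /
      algebraMap (Polynomial ℚ) (RatFunc ℚ) (1 - X ^ 2) := by
    rw [key _ yVar_ne_zero, map_sub, map_one, map_pow, RatFunc.algebraMap_X, yVar]
  have h1 : (1 - X ^ 2 : Polynomial ℚ).eval₂ (algebraMap ℚ (RatFunc ℚ)) (yVar ^ m) =
      1 - (yVar ^ m) ^ 2 := by simp
  rw [e, adams_div, h1, Polynomial.eval₂_X, key _ (h0 m)]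
  rw [h1, ← pow_mul]
  exact one_sub_yVar_pow_ne_zero (mul_ne_zero hm two_ne_zero)

/-! ### The quantum dilogarithm in one variable -/

section OneVariable

open PowerSeries (rescale coeff constantCoeff)

/-- The coefficients `(-y)^{n²} / P(GL_n)`. -/
noncomputable def glCoeff (n : ℕ) : RatFunc ℚ :=
  (-yVar) ^ (n ^ 2) / Polynomial.aeval (yVar ^ 2) (glCount n)

theorem aeval_glCount (n : ℕ) : Polynomial.aeval (yVar ^ 2) (glCount n) =
    ∏ k ∈ Finset.range n, (yVar ^ (2 * n) - yVar ^ (2 * k)) := by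
  simp [glCount, map_prod, pow_mul]

theorem aeval_glCount_ne_zero (n : ℕ) : Polynomial.aeval (yVar ^ 2) (glCount n) ≠ 0 := by
  rw [aeval_glCount, Finset.prod_ne_zero_iff]
  intro k hk h
  have := yVar_pow_injective (sub_eq_zero.1 h)
  have := Finset.mem_range.1 hk
  omega

theorem aeval_glCount_succ (n : ℕ) : Polynomial.aeval (yVar ^ 2) (glCount (n + 1)) =
    (yVar ^ (2 * (n + 1)) - 1) * yVar ^ (2 * n) * Polynomial.aeval (yVar ^ 2) (glCount n) := by
  rw [aeval_glCount, aeval_glCount, Finset.prod_range_succ']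
  have h : ∀ k ∈ Finset.range n, yVar ^ (2 * (n + 1)) - yVar ^ (2 * (k + 1)) =
      yVar ^ 2 * (yVar ^ (2 * n) - yVar ^ (2 * k)) := fun k _ => by ring
  rw [Finset.prod_congr rfl h, Finset.prod_mul_distrib, Finset.prod_const, Finset.card_range]
  ring

theorem glCoeff_zero : glCoeff 0 = 1 := by simp [glCoeff, glCount]

theorem glCoeff_succ (n : ℕ) :
    glCoeff (n + 1) * (1 - yVar ^ (2 * (n + 1))) = yVar * glCoeff n := by
  have h1 : 1 - yVar ^ (2 * (n + 1)) ≠ 0 := one_sub_yVar_pow_ne_zero (by omega)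
  have h1' : yVar ^ (2 * (n + 1)) - 1 ≠ 0 := sub_ne_zero.2 (sub_ne_zero.1 h1).symm
  have h2 := aeval_glCount_ne_zero n
  have h3 : yVar ^ (2 * n) ≠ 0 := pow_ne_zero _ yVar_ne_zero
  have h4 : (-yVar) ^ ((n + 1) ^ 2) = -yVar * yVar ^ (2 * n) * (-yVar) ^ (n ^ 2) := by
    rw [show (n + 1) ^ 2 = n ^ 2 + 2 * n + 1 by ring, pow_add, pow_add, pow_mul (-yVar), neg_sq,
      ← pow_mul]
    ring
  rw [glCoeff, glCoeff, aeval_glCount_succ, h4]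
  field_simp
  ring

/-- The Euler operator `x d/dx`. -/
noncomputable def euler (f : PowerSeries (RatFunc ℚ)) : PowerSeries (RatFunc ℚ) :=
  PowerSeries.X * PowerSeries.derivative (RatFunc ℚ) f

theorem coeff_euler (f : PowerSeries (RatFunc ℚ)) (n : ℕ) :
    coeff n (euler f) = n * coeff n f := by
  cases n with
  | zero => simp [euler]
  | succ n =>
    rw [euler, PowerSeries.coeff_succ_X_mul, PowerSeries.coeff_derivative]
    push_cast
    ring

theorem euler_mul (f g : PowerSeries (RatFunc ℚ)) : euler (f * g) = euler f * g + f * euler g := by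
  simp only [euler, Derivation.leibniz, smul_eq_mul]
  ring

theorem euler_rescale (a : RatFunc ℚ) (f : PowerSeries (RatFunc ℚ)) :
    euler (rescale a f) = rescale a (euler f) := by
  ext n
  simp only [coeff_euler, PowerSeries.coeff_rescale]
  ring

theorem eq_C_of_euler_eq_zero {f : PowerSeries (RatFunc ℚ)} (h : euler f = 0) :
    f = PowerSeries.C (constantCoeff f) := by
  ext n
  rw [PowerSeries.coeff_C]
  split_ifs with hn
  · rw [hn, PowerSeries.coeff_zero_eq_constantCoeff]
  · have := coeff_euler f n
    rw [h, map_zero] at this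
    exact (mul_eq_zero.1 this.symm).resolve_left (Nat.cast_ne_zero.2 hn)

/-- The quantum dilogarithm series `∑ (-y)^{n²} / P(GL_n) xⁿ`. -/
noncomputable def glSeries : PowerSeries (RatFunc ℚ) := PowerSeries.mk glCoeff

/-- The logarithm of the quantum dilogarithm series. -/
noncomputable def glLog : PowerSeries (RatFunc ℚ) :=
  PowerSeries.mk fun n => (n : RatFunc ℚ)⁻¹ * ((yVar ^ n)⁻¹ - yVar ^ n)⁻¹

theorem constantCoeff_glSeries : constantCoeff glSeries = 1 := by
  rw [← PowerSeries.coeff_zero_eq_constantCoeff_apply, glSeries, PowerSeries.coeff_mk, glCoeff_zero]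

theorem constantCoeff_glLog : constantCoeff glLog = 0 := by
  rw [← PowerSeries.coeff_zero_eq_constantCoeff_apply, glLog, PowerSeries.coeff_mk]
  simp

/-- Coefficientwise this is the recursion `glCoeff_succ` divided by `y ^ (n + 1)`: the
`q`-difference equation `F(x/y) (1 - x) = F(xy)`. -/
theorem rescale_glSeries :
    rescale yVar⁻¹ glSeries * (1 - PowerSeries.X) = rescale yVar glSeries := by
  ext n
  rw [mul_sub, mul_one, map_sub, PowerSeries.coeff_rescale, PowerSeries.coeff_rescale, glSeries,
    PowerSeries.coeff_mk]
  cases n with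
  | zero => simp
  | succ n =>
    rw [PowerSeries.coeff_succ_mul_X, PowerSeries.coeff_rescale, PowerSeries.coeff_mk]
    have h0 := yVar_ne_zero
    have h := glCoeff_succ n
    have h1 : glCoeff (n + 1) = yVar * glCoeff n + yVar ^ (2 * (n + 1)) * glCoeff (n + 1) := by
      linear_combination h
    have h2 : yVar⁻¹ ^ (n + 1) * (yVar * glCoeff n) = yVar⁻¹ ^ n * glCoeff n := by
      rw [pow_succ]
      field_simp
    have h3 : yVar⁻¹ ^ (n + 1) * yVar ^ (2 * (n + 1)) = yVar ^ (n + 1) := by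
      rw [two_mul, pow_add yVar, ← mul_assoc, ← mul_pow, inv_mul_cancel₀ h0, one_pow, one_mul]
    linear_combination yVar⁻¹ ^ (n + 1) * h1 + h2 + glCoeff (n + 1) * h3

/-- The logarithmic derivative `E` of the `q`-difference equation satisfies `E(x/y) - E(xy) = x / (1
- x)`, so its `n`-th coefficient is `(y⁻ⁿ - yⁿ)⁻¹` for `n ≥ 1`. -/
theorem euler_glSeries : euler glSeries = euler glLog * glSeries := by
  have hF : constantCoeff glSeries ≠ 0 := by rw [constantCoeff_glSeries]; exact one_ne_zero
  obtain ⟨E, hE⟩ : ∃ E, E = euler glSeries * glSeries⁻¹ := ⟨_, rfl⟩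
  have hEF : euler glSeries = E * glSeries := by
    rw [hE, mul_assoc, PowerSeries.inv_mul_cancel _ hF, mul_one]
  have hX : euler (1 - PowerSeries.X) = -PowerSeries.X := by
    simp [euler]
  have h1 := congrArg euler rescale_glSeries
  rw [euler_mul, euler_rescale, euler_rescale, hEF, map_mul, map_mul, ← rescale_glSeries, hX] at h1
  have hne : rescale yVar⁻¹ glSeries ≠ 0 := fun h => hF <| by
    have := congrArg (coeff 0) h
    simpa using this
  have h2 : (rescale yVar⁻¹ E - rescale yVar E) * (1 - PowerSeries.X) = PowerSeries.X :=
    mul_left_cancel₀ hne (by linear_combination h1)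
  have hE0 : constantCoeff E = 0 := by simp [hE, euler]
  have h3 : ∀ n, coeff (n + 1) (rescale yVar⁻¹ E - rescale yVar E) = 1 := by
    intro n
    have hstep : ∀ k, coeff (k + 1) (rescale yVar⁻¹ E - rescale yVar E) -
        coeff k (rescale yVar⁻¹ E - rescale yVar E) = if k = 0 then 1 else 0 := fun k => by
      have := congrArg (coeff (k + 1)) h2
      rw [mul_sub, mul_one, map_sub, PowerSeries.coeff_succ_mul_X, PowerSeries.coeff_X] at this
      simpa using this
    induction n with
    | zero =>
      have hres : ∀ a, constantCoeff (rescale a E) = 0 := fun a => by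
        rw [← PowerSeries.coeff_zero_eq_constantCoeff_apply, PowerSeries.coeff_rescale]
        simp [hE0]
      have := hstep 0
      simpa [hres] using this
    | succ n ih =>
      have := hstep (n + 1)
      rw [ih, if_neg n.succ_ne_zero] at this
      exact sub_eq_zero.1 this
  have hlog : E = euler glLog := by
    ext n
    rw [coeff_euler, glLog, PowerSeries.coeff_mk]
    cases n with
    | zero => simpa using hE0
    | succ n =>
      have h4 := h3 n
      rw [map_sub, PowerSeries.coeff_rescale, PowerSeries.coeff_rescale, ← sub_mul, inv_pow] at h4
      rw [mul_inv_cancel_left₀ (Nat.cast_ne_zero.2 n.succ_ne_zero)]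
      exact eq_inv_of_mul_eq_one_right h4
  rw [hEF, hlog]

/-- Both sides solve the same first-order linear equation with constant term `1`; their quotient is
killed by the Euler operator, hence constant. -/
theorem exp_subst_glLog : (PowerSeries.exp (RatFunc ℚ)).subst glLog = glSeries := by
  have hs : PowerSeries.HasSubst glLog :=
    PowerSeries.HasSubst.of_constantCoeff_zero' constantCoeff_glLog
  have hF : constantCoeff glSeries ≠ 0 := by rw [constantCoeff_glSeries]; exact one_ne_zero
  set G : PowerSeries (RatFunc ℚ) := (PowerSeries.exp (RatFunc ℚ)).subst glLog with hG
  have hG1 : euler G = euler glLog * G := by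
    rw [euler, hG, PowerSeries.derivative_subst hs, PowerSeries.derivative_exp, euler]
    ring
  have hG0 : constantCoeff G = 1 := by
    have h1 : constantCoeff ((PowerSeries.exp (RatFunc ℚ) - 1).subst glLog :
        PowerSeries (RatFunc ℚ)) = 0 :=
      PowerSeries.constantCoeff_subst_eq_zero constantCoeff_glLog _ (by simp)
    have h2 : ((1 : PowerSeries (RatFunc ℚ)).subst glLog : PowerSeries (RatFunc ℚ)) = 1 := by
      rw [← PowerSeries.coe_substAlgHom hs, map_one]
    rw [PowerSeries.subst_sub hs, h2] at h1
    have h3 : constantCoeff (G - 1) = 0 := h1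
    rw [map_sub, map_one] at h3
    exact sub_eq_zero.1 h3
  set Q := G * glSeries⁻¹ with hQ
  have hGQ : G = Q * glSeries := by
    rw [hQ, mul_assoc, PowerSeries.inv_mul_cancel _ hF, mul_one]
  have hne : glSeries ≠ 0 := fun h => hF (by rw [h, map_zero])
  have hQ0 : euler Q = 0 := by
    refine (mul_eq_zero.1 (?_ : euler Q * glSeries = 0)).resolve_right hne
    rw [hGQ, euler_mul, euler_glSeries] at hG1
    linear_combination hG1
  have hQ1 : constantCoeff Q = 1 := by
    have := congrArg constantCoeff hGQ
    rwa [map_mul, hG0, constantCoeff_glSeries, mul_one, eq_comm] at this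
  rw [hGQ, eq_C_of_euler_eq_zero hQ0, hQ1, map_one, one_mul]

end OneVariable

/-! ### Computation and injectivity of the plethystic exponential -/

section Plethystic

variable {σ : Type u}

theorem coeff_adamsSum (f : MvPowerSeries σ (RatFunc ℚ)) (n : σ →₀ ℕ)
    [DecidablePred fun m => ∀ i, m ∣ n i] :
    MvPowerSeries.coeff n (adamsSum f) =
      ∑ m ∈ (Finset.Icc 1 n.degree).filter (fun m => ∀ i, m ∣ n i),
        ((m : RatFunc ℚ))⁻¹ * adams m
          (MvPowerSeries.coeff (n.mapRange (fun k => k / m) (Nat.zero_div m)) f) := by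
  rw [MvPowerSeries.coeff_apply, adamsSum]
  congr!

theorem constantCoeff_adamsSum (f : MvPowerSeries σ (RatFunc ℚ)) :
    MvPowerSeries.constantCoeff (adamsSum f) = 0 := by
  classical
  rw [← MvPowerSeries.coeff_zero_eq_constantCoeff_apply, coeff_adamsSum]
  simp

theorem hasSubst_adamsSum (f : MvPowerSeries σ (RatFunc ℚ)) :
    PowerSeries.HasSubst (adamsSum f) :=
  PowerSeries.HasSubst.of_constantCoeff_zero (constantCoeff_adamsSum f)

theorem adamsSum_zero : adamsSum (0 : MvPowerSeries σ (RatFunc ℚ)) = 0 := by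
  classical
  ext n
  rw [coeff_adamsSum]
  simp [adams_zero]

theorem plethysticExp_zero : plethysticExp (0 : MvPowerSeries σ (RatFunc ℚ)) = 1 := by
  rw [plethysticExp, adamsSum_zero, PowerSeries.subst_zero_eq_C_constantCoeff]
  simp

/-- If `m` divides `n` and `n / m = e_i`, then `n = m e_i`. So only pure powers of `x_i` occur, each
from the single index `m = n i`. -/
theorem adamsSum_inv_sub_mul_X (i : σ) :
    adamsSum (MvPowerSeries.C (yVar⁻¹ - yVar)⁻¹ * MvPowerSeries.X i) =
      glLog.subst (MvPowerSeries.X i : MvPowerSeries σ (RatFunc ℚ)) := by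
  classical
  ext n
  rw [coeff_adamsSum, PowerSeries.coeff_subst_single, glLog, PowerSeries.coeff_mk]
  have hterm : ∀ m ∈ (Finset.Icc 1 n.degree).filter (fun m => ∀ i, m ∣ n i),
      ((m : RatFunc ℚ))⁻¹ * adams m (MvPowerSeries.coeff
        (n.mapRange (fun k => k / m) (Nat.zero_div m))
        (MvPowerSeries.C (yVar⁻¹ - yVar)⁻¹ * MvPowerSeries.X i)) =
      if n = Finsupp.single i m then (m : RatFunc ℚ)⁻¹ * ((yVar ^ m)⁻¹ - yVar ^ m)⁻¹ else 0 := by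
    intro m hm
    obtain ⟨hm1, hm2⟩ := Finset.mem_filter.1 hm
    have hm0 : m ≠ 0 := by have := (Finset.mem_Icc.1 hm1).1; omega
    have hiff : n.mapRange (fun k => k / m) (Nat.zero_div m) = Finsupp.single i 1 ↔
        n = Finsupp.single i m := by
      constructor
      · intro h
        ext j
        have hj := DFunLike.congr_fun h j
        rw [Finsupp.mapRange_apply] at hj
        rw [← Nat.mul_div_cancel' (hm2 j), hj]
        simp [Finsupp.single_apply]
      · rintro rfl
        rw [Finsupp.mapRange_single, Nat.div_self (Nat.pos_of_ne_zero hm0)]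
    rw [MvPowerSeries.coeff_C_mul, MvPowerSeries.coeff_X]
    simp only [hiff]
    split_ifs
    · rw [mul_one, adams_inv_sub hm0]
    · rw [mul_zero, adams_zero, mul_zero]
  rw [Finset.sum_congr rfl hterm]
  split_ifs with h
  · rw [Finset.sum_eq_single (n i)]
    · rw [if_pos h]
    · intro m _ hne
      rw [if_neg]
      intro h'
      exact hne (by rw [h', Finsupp.single_eq_same])
    -- The index `n i` is out of range only when it is `0`, and then the term vanishes because `0⁻¹
    -- = 0`.
    · intro hni
      have h0 : n i = 0 := by
        by_contra hn0
        apply hni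
        rw [Finset.mem_filter, Finset.mem_Icc]
        refine ⟨⟨Nat.one_le_iff_ne_zero.2 hn0, Finsupp.le_degree i n⟩, fun j => ?_⟩
        rw [h]
        by_cases hj : j = i
        · simp [hj]
        · simp [Ne.symm hj]
      simp [h0]
  · refine Finset.sum_eq_zero fun m _ => ?_
    rw [if_neg]
    rintro rfl
    simp at h

theorem coeff_plethysticExp_inv_sub_mul_X (i : σ) (n : σ →₀ ℕ)
    [Decidable (n = Finsupp.single i (n i))] :
    MvPowerSeries.coeff n
      (plethysticExp (MvPowerSeries.C (yVar⁻¹ - yVar)⁻¹ * MvPowerSeries.X i)) =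
      if n = Finsupp.single i (n i) then glCoeff (n i) else 0 := by
  classical
  have hs : PowerSeries.HasSubst glLog :=
    PowerSeries.HasSubst.of_constantCoeff_zero' constantCoeff_glLog
  rw [plethysticExp, adamsSum_inv_sub_mul_X,
    ← PowerSeries.subst_comp_subst_apply hs (PowerSeries.HasSubst.X i), exp_subst_glLog,
    PowerSeries.coeff_subst_single, glSeries, PowerSeries.coeff_mk]
  congr!

/-- The system is triangular: `m = 1` contributes the coefficient at `n` itself, and `m ≥ 2` only
coefficients of smaller degree. The constant term never enters `adamsSum`, hence `h0`. -/
theorem adamsSum_injective {f g : MvPowerSeries σ (RatFunc ℚ)} (hfg : adamsSum f = adamsSum g)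
    (h0 : MvPowerSeries.constantCoeff f = MvPowerSeries.constantCoeff g) : f = g := by
  classical
  ext n
  induction hd : n.degree using Nat.strong_induction_on generalizing n with
  | _ d ih =>
    subst hd
    by_cases hn : n = 0
    · subst hn
      simpa using h0
    have hdeg : n.degree ≠ 0 := by rwa [Ne, Finsupp.degree_eq_zero_iff]
    have h := congrArg (MvPowerSeries.coeff n) hfg
    have hmem : 1 ∈ (Finset.Icc 1 n.degree).filter (fun m => ∀ i, m ∣ n i) := by
      simp [Nat.one_le_iff_ne_zero, hdeg]
    rw [coeff_adamsSum, coeff_adamsSum, ← Finset.add_sum_erase _ _ hmem,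
      ← Finset.add_sum_erase _ _ hmem] at h
    have hone : n.mapRange (fun k => k / 1) (Nat.zero_div 1) = n := by ext; simp
    rw [hone, adams_one, adams_one, Nat.cast_one, inv_one, one_mul, one_mul] at h
    refine add_right_cancel (h.trans ?_)
    congr 1
    refine (Finset.sum_congr rfl fun m hm => ?_).symm
    obtain ⟨hm1, hm⟩ := Finset.mem_erase.1 hm
    obtain ⟨hm2, hm3⟩ := Finset.mem_filter.1 hm
    have hm4 := (Finset.mem_Icc.1 hm2).1
    rw [ih _ ?_ _ rfl]
    set n' := n.mapRange (fun k => k / m) (Nat.zero_div m) with hn'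
    have e : n = m • n' := by
      ext j
      simp [hn', Nat.mul_div_cancel' (hm3 j)]
    have e' : n.degree = m * n'.degree := by
      conv_lhs => rw [e]
      simp
    have : n'.degree ≠ 0 := by
      intro h; rw [h, mul_zero] at e'; exact hdeg e'
    rw [e']
    nlinarith [Nat.pos_of_ne_zero this, (show 2 ≤ m by omega)]

/-- `exp - 1` has zero constant term and unit linear coefficient, so it has a compositional inverse,
a logarithm. -/
theorem exp_subst_injective {f g : MvPowerSeries σ (RatFunc ℚ)} (hf : PowerSeries.HasSubst f)
    (hg : PowerSeries.HasSubst g)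
    (h : (PowerSeries.exp (RatFunc ℚ)).subst f = (PowerSeries.exp (RatFunc ℚ)).subst g) :
    f = g := by
  set P : PowerSeries (RatFunc ℚ) := PowerSeries.exp (RatFunc ℚ) - 1 with hP
  have hP0 : PowerSeries.constantCoeff P = 0 := by simp [hP]
  have hP1 : IsUnit (PowerSeries.coeff 1 P) := by
    simp [hP, PowerSeries.coeff_exp, PowerSeries.coeff_one]
  have hPs : PowerSeries.HasSubst P := PowerSeries.HasSubst.of_constantCoeff_zero' hP0
  have key : ∀ a : MvPowerSeries σ (RatFunc ℚ), PowerSeries.HasSubst a →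
      (P.substInvOfIsUnit hP1).subst ((PowerSeries.exp (RatFunc ℚ)).subst a - 1) = a := by
    intro a ha
    have h1 : (PowerSeries.exp (RatFunc ℚ)).subst a - 1 = P.subst a := by
      rw [hP, PowerSeries.subst_sub ha, ← PowerSeries.coe_substAlgHom ha, map_one]
    rw [h1, ← PowerSeries.subst_comp_subst_apply hPs ha,
      PowerSeries.subst_substInvOfIsUnit_left P hP0 hP1, PowerSeries.subst_X ha]
  rw [← key f hf, ← key g hg, h]

theorem plethysticExp_injective {f g : MvPowerSeries σ (RatFunc ℚ)}
    (hfg : plethysticExp f = plethysticExp g)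
    (h0 : MvPowerSeries.constantCoeff f = MvPowerSeries.constantCoeff g) : f = g :=
  adamsSum_injective (exp_subst_injective (hasSubst_adamsSum f) (hasSubst_adamsSum g) hfg) h0

theorem sum_GL_eq_plethysticExp :
    (fun n : Unit →₀ ℕ => (-yVar) ^ (n () ^ 2) / vP (GLSet (n ())) :
        MvPowerSeries Unit (RatFunc ℚ)) =
      plethysticExp (MvPowerSeries.C (yVar⁻¹ - yVar)⁻¹ * MvPowerSeries.X ()) := by
  classical
  funext n
  rw [vP_GLSet]
  refine Eq.trans ?_ (coeff_plethysticExp_inv_sub_mul_X () n).symm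
  rw [if_pos (by ext; simp), glCoeff]

end Plethystic

/-! ### Sinks, subrepresentations and semistable loci -/

section Pairing

variable {V : Type u} [Fintype V]

theorem weightPairing_single [DecidableEq V] (θ : V → ℝ) (i : V) (n : ℕ) :
    weightPairing θ (Pi.single i n) = θ i * n := by
  rw [weightPairing, Finset.sum_eq_single i]
  · rw [Pi.single_eq_same]
  · intro j _ hj
    rw [Pi.single_eq_of_ne hj, Nat.cast_zero, mul_zero]
  · simp

theorem weightPairing_zero (θ : V → ℝ) : weightPairing θ (0 : V → ℕ) = 0 := by
  simp [weightPairing]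

end Pairing

section Quivers

variable {V : Type u} [Quiver.{v} V]

theorem IsAcyclicQuiver.isEmpty_hom_self (hQ : IsAcyclicQuiver V) (i : V) : IsEmpty (i ⟶ i) :=
  ⟨fun a => absurd (hQ i a.toPath) (by simp)⟩

/-- In an acyclic quiver with finitely many vertices, each nonempty set of vertices has a sink. -/
theorem IsAcyclicQuiver.exists_sink [Finite V] (hQ : IsAcyclicQuiver V) {P : Set V}
    (hP : P.Nonempty) : ∃ i ∈ P, ∀ j ∈ P, IsEmpty (i ⟶ j) := by
  -- Reachability by nontrivial paths is transitive, and irreflexive by acyclicity, hence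
  -- well-founded on a finite set. A minimal element is a sink.
  let r : V → V → Prop := fun j i => ∃ p : Quiver.Path i j, p.length ≠ 0
  have : IsTrans V r := ⟨fun a b c ⟨p, hp⟩ ⟨q, hq⟩ => ⟨q.comp p, by
    rw [Quiver.Path.length_comp]; omega⟩⟩
  have : Std.Irrefl r := ⟨fun a ⟨p, hp⟩ => hp (hQ a p)⟩
  obtain ⟨i, hi, hmin⟩ := (Finite.wellFounded_of_trans_of_irrefl r).has_min P hP
  exact ⟨i, hi, fun j hj => ⟨fun a => hmin j hj ⟨a.toPath, by simp⟩⟩⟩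

namespace QRep

variable (M : QRep.{u, v, w} V)

theorem dimVec_eq_zero_iff {i : V} : M.dimVec i = 0 ↔ Subsingleton (M.obj i) :=
  Module.finrank_zero_iff

variable {M} in
theorem Sub.dimVec_le (N : M.Sub) (i : V) : N.dimVec i ≤ M.dimVec i :=
  Submodule.finrank_le _

variable [DecidableEq V]

/-- A subspace at a sink of the support is a subrepresentation. -/
def subAtSink (i : V) (hi : ∀ j, M.dimVec j ≠ 0 → IsEmpty (i ⟶ j)) (W : Submodule ℂ (M.obj i)) :
    M.Sub where
  space := Function.update (fun _ => ⊥) i W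
  map_mem := by
    intro k l a x hx
    by_cases hk : k = i
    · subst hk
      have : Subsingleton (M.obj l) := M.dimVec_eq_zero_iff.1 <| by
        by_contra h
        exact (hi l h).false a
      rw [Subsingleton.elim (M.map a x) 0]
      exact Submodule.zero_mem _
    · rw [Function.update_of_ne hk, Submodule.mem_bot] at hx
      rw [hx, map_zero]
      exact Submodule.zero_mem _

theorem subAtSink_space_self (i : V) (hi : ∀ j, M.dimVec j ≠ 0 → IsEmpty (i ⟶ j))
    (W : Submodule ℂ (M.obj i)) : (M.subAtSink i hi W).space i = W := by
  dsimp only [subAtSink]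
  exact Function.update_self ..

theorem subAtSink_space_of_ne (i : V) (hi : ∀ j, M.dimVec j ≠ 0 → IsEmpty (i ⟶ j))
    (W : Submodule ℂ (M.obj i)) {k : V} (hk : k ≠ i) : (M.subAtSink i hi W).space k = ⊥ := by
  dsimp only [subAtSink]
  exact Function.update_of_ne hk ..

theorem dimVec_subAtSink (i : V) (hi : ∀ j, M.dimVec j ≠ 0 → IsEmpty (i ⟶ j))
    (W : Submodule ℂ (M.obj i)) :
    (M.subAtSink i hi W).dimVec = Pi.single i (Module.finrank ℂ W) := by
  funext k
  by_cases hk : k = i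
  · subst hk
    rw [Pi.single_eq_same, Sub.dimVec, subAtSink_space_self]
  · rw [Pi.single_eq_of_ne hk, Sub.dimVec, subAtSink_space_of_ne _ _ _ _ hk, finrank_bot]

end QRep

theorem dimVec_repOfPoint (d : V → ℕ) (ρ : RepCoord d → ℂ) : (repOfPoint d ρ).dimVec = d := by
  funext i
  exact Module.finrank_fin_fun ℂ

theorem dimVec_vertexSimple [DecidableEq V] (j : V) :
    (vertexSimple j : QRep.{u, v, 0} V).dimVec = Pi.single j 1 :=
  dimVec_repOfPoint _ _

theorem QRep.Iso.dimVec_eq {M : QRep.{u, v, w} V} {M' : QRep.{u, v, 0} V} (e : M.Iso M') :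
    M.dimVec = M'.dimVec :=
  funext fun i => (e.equiv i).finrank_eq

/-- There are no loops, so every arrow starts or ends at a zero space and any choice of linear
isomorphisms commutes with it. -/
theorem QRep.nonempty_iso_vertexSimple [DecidableEq V] (hQ : IsAcyclicQuiver V)
    {M : QRep.{u, v, w} V} {j : V} (hM : M.dimVec = Pi.single j 1) :
    Nonempty (M.Iso (vertexSimple j)) := by
  have hdim : ∀ k, Module.finrank ℂ (M.obj k) =
      Module.finrank ℂ ((vertexSimple j : QRep.{u, v, 0} V).obj k) := fun k =>
    (congrFun hM k).trans (congrFun (dimVec_vertexSimple j) k).symm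
  refine ⟨⟨fun k => LinearEquiv.ofFinrankEq _ _ (hdim k), fun {k l} a x => ?_⟩⟩
  by_cases hl : l = j
  · have hk : k ≠ j := by
      rintro rfl
      subst hl
      exact (hQ.isEmpty_hom_self l).false a
    have : Subsingleton (M.obj k) := M.dimVec_eq_zero_iff.1 (by rw [hM, Pi.single_eq_of_ne hk])
    rw [Subsingleton.elim x 0]
    simp
  · have : Subsingleton ((vertexSimple j : QRep.{u, v, 0} V).obj l) :=
      (QRep.dimVec_eq_zero_iff _).1 (by rw [dimVec_vertexSimple, Pi.single_eq_of_ne hl])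
    exact Subsingleton.elim _ _

theorem sum_card_hom_mul_eq_zero [Fintype V] [∀ i j : V, Fintype (i ⟶ j)] {d : V → ℕ} {i : V}
    (hi : ∀ j, d j ≠ 0 → IsEmpty (i ⟶ j)) :
    ∑ j, (Fintype.card (i ⟶ j) : ℝ) * d j = 0 := by
  refine Finset.sum_eq_zero fun j _ => ?_
  by_cases hj : d j = 0
  · simp [hj]
  · have := hi j hj
    simp

/-- If `θ` is positive at a sink of the support of `d`, no representation of dimension vector `d`
is `θ`-semistable. -/
theorem semistableLocus_eq_empty [Fintype V] [DecidableEq V] {θ : V → ℝ} {d : V → ℕ} {i : V}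
    (hdi : d i ≠ 0) (hi : ∀ j, d j ≠ 0 → IsEmpty (i ⟶ j)) (hθ : 0 < θ i) :
    semistableLocus θ d = ∅ := by
  refine Set.eq_empty_of_forall_notMem fun ρ hρ => ?_
  have hi' : ∀ j, (repOfPoint d ρ).dimVec j ≠ 0 → IsEmpty (i ⟶ j) := by
    rwa [dimVec_repOfPoint]
  have h := hρ.2 ((repOfPoint d ρ).subAtSink i hi' ⊤)
  rw [QRep.dimVec_subAtSink, weightPairing_single, finrank_top] at h
  have h1 : Module.finrank ℂ ((repOfPoint d ρ).obj i) = d i := congrFun (dimVec_repOfPoint d ρ) i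
  rw [h1] at h
  have : (0 : ℝ) < d i := by exact_mod_cast Nat.pos_of_ne_zero hdi
  exact h.not_gt (mul_pos hθ this)

theorem isEmpty_repCoord_single [DecidableEq V] (hQ : IsAcyclicQuiver V) (i : V) (n : ℕ) :
    IsEmpty (RepCoord (Pi.single i n : V → ℕ)) := by
  refine ⟨fun ⟨k, l, a, r, c⟩ => ?_⟩
  have key : ∀ m, Fin ((Pi.single i n : V → ℕ) m) → m = i := fun m x => by
    by_contra h
    rw [Pi.single_eq_of_ne h] at x
    exact x.elim0
  obtain rfl := key l r
  obtain rfl := key k c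
  exact (hQ.isEmpty_hom_self k).false a

/-- Subrepresentations also live only at `i`, so all weights are zero. The alternative `n = 0`
serves the constant term of the stacky series, where `θ` is arbitrary. -/
theorem semistableLocus_single [Fintype V] [DecidableEq V] {θ : V → ℝ} {i : V} {n : ℕ}
    (h : θ i = 0 ∨ n = 0) :
    semistableLocus θ (Pi.single i n : V → ℕ) = Set.univ := by
  refine Set.eq_univ_of_forall fun ρ => ⟨?_, fun N => le_of_eq ?_⟩
  · rw [dimVec_repOfPoint, weightPairing_single]
    rcases h with h | h <;> simp [h]
  · have hN : ∀ k, N.dimVec k ≤ (Pi.single i n : V → ℕ) k := fun k =>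
      (N.dimVec_le k).trans (congrFun (dimVec_repOfPoint _ ρ) k).le
    refine Finset.sum_eq_zero fun k _ => ?_
    by_cases hk : k = i
    · subst hk
      rcases h with h | h
      · rw [h, zero_mul]
      · have : N.dimVec k = 0 :=
          Nat.le_zero.1 (((hN k).trans_eq (Pi.single_eq_same (M := fun _ : V => ℕ) k n)).trans_eq h)
        rw [this, Nat.cast_zero, mul_zero]
    · have : N.dimVec k = 0 := Nat.le_zero.1
        ((hN k).trans_eq (Pi.single_eq_of_ne (M := fun _ : V => ℕ) hk n))
      rw [this, Nat.cast_zero, mul_zero]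

end Quivers

/-! ### Self-stable representations and values of the stacky invariants -/

section Weights

variable {V : Type u} [Quiver.{v} V] [Fintype V] [DecidableEq V] [∀ i j : V, Fintype (i ⟶ j)]

theorem selfWeight_apply (d : V → ℕ) (i : V) :
    selfWeight d i = ∑ j, (Fintype.card (j ⟶ i) : ℝ) * d j -
      ∑ j, (Fintype.card (i ⟶ j) : ℝ) * d j := by
  have h1 : eulerForm (Pi.single i 1) (fun k => (d k : ℤ)) =
      d i - ∑ j, (Fintype.card (i ⟶ j) : ℤ) * d j := by
    simp [eulerForm, Pi.single_apply]
  have h2 : eulerForm (fun k => (d k : ℤ)) (Pi.single i 1) =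
      d i - ∑ j, (Fintype.card (j ⟶ i) : ℤ) * d j := by
    simp [eulerForm, Pi.single_apply]
  rw [selfWeight, skewForm, h1, h2]
  push_cast
  ring

theorem weightPairing_selfWeight (d : V → ℕ) : weightPairing (selfWeight d) d = 0 := by
  simp only [weightPairing, selfWeight_apply, sub_mul, Finset.sum_sub_distrib, Finset.sum_mul]
  rw [Finset.sum_comm, sub_eq_zero]
  refine Finset.sum_congr rfl fun i _ => Finset.sum_congr rfl fun j _ => ?_
  ring

theorem selfWeight_of_sink {d : V → ℕ} {i : V} (hi : ∀ j, d j ≠ 0 → IsEmpty (i ⟶ j)) :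
    selfWeight d i = ∑ j, (Fintype.card (j ⟶ i) : ℝ) * d j := by
  rw [selfWeight_apply, sum_card_hom_mul_eq_zero hi, sub_zero]

theorem isSelfStable_iff (hQ : IsAcyclicQuiver V) (M : QRep.{u, v, w} V) :
    M.IsSelfStable ↔ ∃ j : V, Nonempty (M.Iso (vertexSimple j)) := by
  constructor
  · rintro ⟨⟨i₀, hi₀⟩, -, hstab⟩
    obtain ⟨i, hi, hsink⟩ := hQ.exists_sink (P := {i | M.dimVec i ≠ 0}) ⟨i₀, fun h =>
      not_subsingleton _ (M.dimVec_eq_zero_iff.1 h)⟩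
    have : Nontrivial (M.obj i) := by
      by_contra h
      exact hi (M.dimVec_eq_zero_iff.2 (not_nontrivial_iff_subsingleton.1 h))
    obtain ⟨x, hx⟩ := exists_ne (0 : M.obj i)
    -- A line at a sink of the support: its weight is nonnegative, so stability forces it to be all
    -- of `M`.
    set N := M.subAtSink i hsink (Submodule.span ℂ {x}) with hN
    have hNi : N.space i = Submodule.span ℂ {x} := M.subAtSink_space_self ..
    have hdim : N.dimVec = Pi.single i 1 := by
      rw [hN, M.dimVec_subAtSink, finrank_span_singleton hx]
    refine ⟨i, QRep.nonempty_iso_vertexSimple hQ ?_⟩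
    rw [← hdim]
    by_contra hne
    have hproper : ∃ k, N.space k ≠ ⊤ := by
      by_contra! hall
      exact hne (funext fun k => by rw [QRep.Sub.dimVec, hall k, finrank_top]; rfl)
    have hlt := hstab N ⟨i, by rw [hNi]; simpa using hx⟩ hproper
    rw [hdim, weightPairing_single, selfWeight_of_sink hsink, Nat.cast_one, mul_one] at hlt
    exact hlt.not_ge (Finset.sum_nonneg fun j _ => by positivity)
  · rintro ⟨j, ⟨e⟩⟩
    have hM : M.dimVec = Pi.single j 1 := e.dimVec_eq.trans (dimVec_vertexSimple j)
    refine ⟨⟨j, ?_⟩, weightPairing_selfWeight _, fun N ⟨k, hk⟩ ⟨l, hl⟩ => ?_⟩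
    · rw [← not_subsingleton_iff_nontrivial, ← M.dimVec_eq_zero_iff, hM]
      simp
    · have hsub : ∀ m, m ≠ j → Subsingleton (M.obj m) := fun m hm =>
        M.dimVec_eq_zero_iff.1 (by rw [hM, Pi.single_eq_of_ne hm])
      have hkj : k = j := by
        by_contra h
        have := hsub k h
        exact hk (Subsingleton.elim _ _)
      have hlj : l = j := by
        by_contra h
        have := hsub l h
        exact hl (Subsingleton.elim _ _)
      subst hkj hlj
      refine absurd (Submodule.eq_top_of_finrank_eq (le_antisymm (Submodule.finrank_le _) ?_)) hl
      have h1 : Module.finrank ℂ (M.obj l) = 1 := (congrFun hM l).trans (Pi.single_eq_same ..)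
      rw [h1]
      exact Nat.one_le_iff_ne_zero.2 fun h0 => hk (Submodule.finrank_eq_zero.1 h0)

theorem stackyInvariant_eq_zero {θ : V → ℝ} {d : V → ℕ} {i : V} (hdi : d i ≠ 0)
    (hi : ∀ j, d j ≠ 0 → IsEmpty (i ⟶ j)) (hθ : 0 < θ i) : stackyInvariant θ d = 0 := by
  rw [stackyInvariant, semistableLocus_eq_empty hdi hi hθ, vP_empty, zero_div, mul_zero]

/-- Without loops the representation space is a point, and the Euler form of `n e_i` is `n²`. -/
theorem stackyInvariant_single (hQ : IsAcyclicQuiver V) {θ : V → ℝ} {i : V} {n : ℕ}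
    (h : θ i = 0 ∨ n = 0) : stackyInvariant θ (Pi.single i n : V → ℕ) = glCoeff n := by
  have := isEmpty_repCoord_single hQ i n
  have hcast : (fun k => ((Pi.single i n : V → ℕ) k : ℤ)) = Pi.single i (n : ℤ) := by
    funext k
    by_cases hk : k = i
    · subst hk; simp
    · simp [Pi.single_eq_of_ne hk]
  have hχ : eulerForm (Pi.single i (n : ℤ) : V → ℤ) (Pi.single i (n : ℤ)) = (n ^ 2 : ℕ) := by
    have := hQ.isEmpty_hom_self i
    simp [eulerForm, Pi.single_apply, pow_two]
  have hG : vP (gaugeGroup (Pi.single i n : V → ℕ)) =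
      Polynomial.aeval (yVar ^ 2) (glCount n) := by
    rw [vP_gaugeGroup, Finset.prod_eq_single i]
    · rw [Pi.single_eq_same]
    · intro k _ hk
      rw [Pi.single_eq_of_ne hk]
      simp [glCount]
    · simp
  rw [stackyInvariant, hcast, hχ, hG, semistableLocus_single h, vP_univ, zpow_natCast, glCoeff,
    mul_one_div]

end Weights

/-! ### Generic weights and their density -/

section Generic

variable {V : Type u} [Fintype V]

theorem mem_ker_linearCombination {θ : V → ℝ} {d : V → ℕ} (h : weightPairing θ d = 0) :
    (fun i => (d i : ℤ)) ∈ LinearMap.ker (Fintype.linearCombination ℤ θ) := by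
  rw [LinearMap.mem_ker, Fintype.linearCombination_apply, ← h, weightPairing]
  refine Finset.sum_congr rfl fun i _ => ?_
  rw [zsmul_eq_mul, mul_comm]
  push_cast
  rfl

/-- For a generic weight `θ`, the supports of the dimension vectors in the kernel of `θ` lie in the
support of any nonzero one. -/
theorem IsGenericWeight.eq_zero_of_eq_zero {θ : V → ℝ} (hθ : IsGenericWeight θ) {d d' : V → ℕ}
    (hd : weightPairing θ d = 0) (hd' : weightPairing θ d' = 0) (hd0 : d ≠ 0)
    {i : V} (hi : d i = 0) : d' i = 0 := by
  set K := LinearMap.ker (Fintype.linearCombination ℤ θ)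
  let x : K := ⟨_, mem_ker_linearCombination hd⟩
  let x' : K := ⟨_, mem_ker_linearCombination hd'⟩
  -- In rank one `d` and `d'` satisfy a nontrivial relation `s d + t d' = 0`; since `d ≠ 0`, the
  -- coefficient `t` is nonzero.
  have hnli : ¬ LinearIndependent ℤ ![x, x'] := fun h => by
    have h1 := h.fintype_card_le_finrank
    rw [show Module.finrank ℤ K = 1 from hθ] at h1
    simp at h1
  rw [LinearIndependent.pair_iff] at hnli
  push Not at hnli
  obtain ⟨s, t, hst, hne⟩ := hnli
  have hpt : ∀ j, s * d j + t * d' j = 0 := fun j =>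
    congrFun (congrArg Subtype.val hst) j
  have ht : t ≠ 0 := by
    intro ht
    have hs : s ≠ 0 := fun hs => hne hs ht
    exact hd0 (funext fun j => by simpa [ht, hs] using hpt j)
  simpa [hi, ht] using hpt i

/-- All integer vectors in the kernel are proportional to `d`, so the `i`-th coordinate is injective
there and the rank is at most one; `d` itself makes it positive. -/
theorem isGenericWeight_of_forall {θ : V → ℝ} {d : V → ℕ} (hd : weightPairing θ d = 0) {i : V}
    (hi : d i ≠ 0)
    (hθ : ∀ e : V → ℤ, (∃ j, (d i : ℤ) * e j ≠ d j * e i) → ∑ j, θ j * (e j : ℝ) ≠ 0) :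
    IsGenericWeight θ := by
  set K := LinearMap.ker (Fintype.linearCombination ℤ θ) with hK
  have hle : Module.finrank ℤ K ≤ 1 := by
    rw [← Module.finrank_self ℤ]
    refine LinearMap.finrank_le_finrank_of_injective (f := (LinearMap.proj i).comp K.subtype) ?_
    rw [injective_iff_map_eq_zero]
    rintro ⟨e, he⟩ (hei : e i = 0)
    have hprop : ∀ j, (d i : ℤ) * e j = d j * e i := by
      by_contra! hex
      refine hθ e hex ?_
      rw [hK, LinearMap.mem_ker, Fintype.linearCombination_apply] at he
      rw [← he]
      refine Finset.sum_congr rfl fun j _ => ?_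
      rw [zsmul_eq_mul, mul_comm]
    ext j
    have := hprop j
    rw [hei, mul_zero] at this
    exact (mul_eq_zero.1 this).resolve_left (by exact_mod_cast hi)
  have hpos : 0 < Module.finrank ℤ K := by
    have : Nontrivial K := by
      refine ⟨⟨⟨_, mem_ker_linearCombination hd⟩, 0, fun h => hi ?_⟩⟩
      have h' : (d i : ℤ) = 0 := congrFun (congrArg Subtype.val h) i
      exact_mod_cast h'
    exact Module.finrank_pos
  exact le_antisymm hle hpos

/-- The hyperplane `d^⊥` of weights. -/
noncomputable def orthogonalWeights (d : V → ℕ) : Submodule ℝ (V → ℝ) :=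
  LinearMap.ker (∑ i, (d i : ℝ) • LinearMap.proj (R := ℝ) (φ := fun _ : V => ℝ) i)

theorem mem_orthogonalWeights {d : V → ℕ} {θ : V → ℝ} :
    θ ∈ orthogonalWeights d ↔ weightPairing θ d = 0 := by
  simp [orthogonalWeights, LinearMap.mem_ker, weightPairing, LinearMap.sum_apply, mul_comm]

theorem dense_setOf_pairing_ne_zero [DecidableEq V] {d : V → ℕ} {e : V → ℤ} {i j : V}
    (hij : (d i : ℤ) * e j ≠ d j * e i) :
    Dense {θ : orthogonalWeights d | ∑ k, θ.1 k * (e k : ℝ) ≠ 0} := by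
  let ℓ : (V → ℝ) →ₗ[ℝ] ℝ := ∑ k, (e k : ℝ) • LinearMap.proj (R := ℝ) (φ := fun _ : V => ℝ) k
  have hℓ : ∀ θ, ℓ θ = ∑ k, θ k * (e k : ℝ) := fun θ => by
    simp [ℓ, LinearMap.sum_apply, mul_comm]
  -- This weight kills `d` and takes the value `d_i e_j - d_j e_i ≠ 0` on `e`. So `e` vanishes only
  -- on a proper subspace of `d^⊥`, which has empty interior.
  let θ₀ : V → ℝ := Pi.single j (d i : ℝ) - Pi.single i (d j : ℝ)
  have hθ₀ : θ₀ ∈ orthogonalWeights d := by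
    rw [mem_orthogonalWeights]
    simp [θ₀, weightPairing, sub_mul, Pi.single_apply, mul_comm (d i : ℝ)]
  have hne : ℓ θ₀ ≠ 0 := by
    have h1 : ℓ θ₀ = ((d i * e j - d j * e i : ℤ) : ℝ) := by
      rw [hℓ]
      simp [θ₀, sub_mul, Pi.single_apply]
    rw [h1, Int.cast_ne_zero]
    exact sub_ne_zero.2 hij
  have hint : interior (LinearMap.ker (ℓ.comp (orthogonalWeights d).subtype) :
      Set (orthogonalWeights d)) = ∅ := by
    by_contra h
    have htop := Submodule.eq_top_of_nonempty_interior' _ (Set.nonempty_iff_ne_empty.2 h)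
    have hmem : (⟨θ₀, hθ₀⟩ : orthogonalWeights d) ∈
        LinearMap.ker (ℓ.comp (orthogonalWeights d).subtype) := by
      rw [htop]; exact Submodule.mem_top
    exact hne hmem
  rw [interior_eq_empty_iff_dense_compl] at hint
  convert hint using 1
  ext θ
  simp [hℓ]

/-- Generic weights are dense in `d^⊥`. -/
theorem orthogonalWeights_subset_closure_genericWeights {d : V → ℕ} (hd : d ≠ 0) {θ : V → ℝ}
    (hθ : weightPairing θ d = 0) : θ ∈ closure (genericWeights d) := by
  classical
  obtain ⟨i, hi⟩ := Function.ne_iff.1 hd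
  have : CompleteSpace (orthogonalWeights d) := FiniteDimensional.complete ℝ _
  let S : Set (V → ℤ) := {e | ∃ j, (d i : ℤ) * e j ≠ d j * e i}
  -- Baire: only countably many integer vectors must be avoided, each on a dense open set.
  have hdense : Dense (⋂ e ∈ S, {θ : orthogonalWeights d | ∑ k, θ.1 k * (e k : ℝ) ≠ 0}) := by
    refine dense_biInter_of_isOpen (fun e _ => ?_) (Set.to_countable S) fun e ⟨j, hj⟩ =>
      dense_setOf_pairing_ne_zero hj
    refine isOpen_ne_fun ?_ continuous_const
    exact continuous_finsetSum _ fun k _ =>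
      ((continuous_apply k).comp continuous_subtype_val).mul continuous_const
  have hmem := image_closure_subset_closure_image continuous_subtype_val
    (Set.mem_image_of_mem Subtype.val (hdense ⟨θ, mem_orthogonalWeights.2 hθ⟩))
  refine closure_mono ?_ hmem
  rintro _ ⟨η, hη, rfl⟩
  have hη0 := mem_orthogonalWeights.1 η.2
  exact ⟨hη0, isGenericWeight_of_forall hη0 hi fun e he => Set.mem_iInter₂.1 hη e he⟩

open Classical in
/-- The series `∑_{θ(d) = 0, d ≠ 0} Ω(d, y) x^d / (y⁻¹ - y)`. -/
noncomputable def dtSeries (θ : V → ℝ) (Ω : (V → ℕ) → RatFunc ℚ) : MvPowerSeries V (RatFunc ℚ) :=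
  fun n => if weightPairing θ n = 0 ∧ n ≠ 0 then Ω n / (yVar⁻¹ - yVar) else 0

theorem coeff_dtSeries (θ : V → ℝ) (Ω : (V → ℕ) → RatFunc ℚ) (n : V →₀ ℕ)
    [Decidable (weightPairing θ n = 0 ∧ n ≠ 0)] : MvPowerSeries.coeff n (dtSeries θ Ω) =
      if weightPairing θ n = 0 ∧ n ≠ 0 then Ω n / (yVar⁻¹ - yVar) else 0 := by
  rw [MvPowerSeries.coeff_apply, dtSeries]
  congr!

theorem constantCoeff_dtSeries (θ : V → ℝ) (Ω : (V → ℕ) → RatFunc ℚ) :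
    MvPowerSeries.constantCoeff (dtSeries θ Ω) = 0 := by
  classical
  rw [← MvPowerSeries.coeff_zero_eq_constantCoeff_apply, coeff_dtSeries, if_neg (by simp)]

theorem coeff_stackySeries [Quiver.{v} V] [∀ i j : V, Fintype (i ⟶ j)] (θ : V → ℝ) (n : V →₀ ℕ)
    [Decidable (weightPairing θ n = 0)] :
    MvPowerSeries.coeff n (stackySeries θ) =
      if weightPairing θ n = 0 then stackyInvariant θ n else 0 := by
  rw [MvPowerSeries.coeff_apply, stackySeries]
  congr!

end Generic

/-! ### Integer DT invariants and attractor invariants -/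

section Attractor

variable {V : Type u} [Quiver.{v} V] [Fintype V] [DecidableEq V] [∀ i j : V, Fintype (i ⟶ j)]

theorem isIntegerDTFamily_iff {θ : V → ℝ} {Ω : (V → ℕ) → RatFunc ℚ} :
    IsIntegerDTFamily θ Ω ↔
      (stackySeries θ : MvPowerSeries V (RatFunc ℚ)) = plethysticExp (dtSeries θ Ω) := by
  refine iff_of_eq (congrArg (fun f => stackySeries θ = plethysticExp f) ?_)
  funext n
  rw [dtSeries]
  congr!

/-- Uniqueness is injectivity of `Exp` followed by division by `y⁻¹ - y ≠ 0`. Families are pinned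
down only on nonzero vectors of `θ^⊥`, hence the conditions on `d`. -/
theorem IsIntegerDTFamily.hasIntegerDT {θ : V → ℝ} {Ω : (V → ℕ) → RatFunc ℚ}
    (hΩ : IsIntegerDTFamily θ Ω) {d : V → ℕ} (hd : weightPairing θ d = 0) (hd0 : d ≠ 0) :
    HasIntegerDT θ d (Ω d) := by
  classical
  refine ⟨⟨Ω, hΩ⟩, fun Ω' hΩ' => ?_⟩
  let n : V →₀ ℕ := Finsupp.equivFunOnFinite.symm d
  have hn : (n : V → ℕ) = d := rfl
  have hn0 : n ≠ 0 := fun h => hd0 (by rw [← hn, h]; rfl)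
  have h := congrArg (MvPowerSeries.coeff n) (plethysticExp_injective
    ((isIntegerDTFamily_iff.1 hΩ').symm.trans (isIntegerDTFamily_iff.1 hΩ))
    ((constantCoeff_dtSeries θ Ω').trans (constantCoeff_dtSeries θ Ω).symm))
  have hcond : weightPairing θ n = 0 ∧ n ≠ 0 := ⟨hd, hn0⟩
  have hy : yVar⁻¹ - yVar ≠ 0 := by simpa using inv_sub_yVar_pow_ne_zero one_ne_zero
  rw [coeff_dtSeries, coeff_dtSeries, if_pos hcond, if_pos hcond, div_left_inj' hy] at h
  exact h

theorem stackyInvariant_zero (hQ : IsAcyclicQuiver V) [Nonempty V] (θ : V → ℝ) :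
    stackyInvariant θ (0 : V → ℕ) = 1 := by
  have := stackyInvariant_single hQ (θ := θ) (i := Classical.arbitrary V) (n := 0) (Or.inr rfl)
  rwa [Pi.single_zero, glCoeff_zero] at this

/-- By genericity every nonzero dimension vector in `θ^⊥` has the support of `d`, so the same sink
`i` empties its semistable locus, and the stacky series is `1`. -/
theorem isIntegerDTFamily_zero (hQ : IsAcyclicQuiver V) {θ : V → ℝ} (hθ : IsGenericWeight θ)
    {d : V → ℕ} (hd : weightPairing θ d = 0) {i : V} (hdi : d i ≠ 0)
    (hi : ∀ j, d j ≠ 0 → IsEmpty (i ⟶ j)) (hpos : 0 < θ i) :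
    IsIntegerDTFamily θ 0 := by
  classical
  have : Nonempty V := ⟨i⟩
  have hd0 : d ≠ 0 := fun h => hdi (congrFun h i)
  have hzero : dtSeries θ 0 = 0 := by
    ext n
    rw [coeff_dtSeries, Pi.zero_apply, zero_div, ite_self, map_zero]
  rw [isIntegerDTFamily_iff, hzero, plethysticExp_zero]
  ext n
  rw [MvPowerSeries.coeff_one, coeff_stackySeries]
  by_cases hn : n = 0
  · subst hn
    rw [if_pos rfl, Finsupp.coe_zero, if_pos (weightPairing_zero θ), stackyInvariant_zero hQ]
  · rw [if_neg hn]
    split_ifs with h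
    · have hn0 : (n : V → ℕ) ≠ 0 := fun h => hn (DFunLike.coe_injective h)
      refine stackyInvariant_eq_zero (i := i) (fun h' => hdi ?_) (fun j hj => hi j fun h' => hj ?_)
        hpos
      · exact hθ.eq_zero_of_eq_zero h hd hn0 h'
      · exact hθ.eq_zero_of_eq_zero hd h hd0 h'
    · rfl

/-- The dimension vectors in `θ^⊥` are exactly the multiples of `e_i`, so the stacky series is the
quantum dilogarithm in `x_i`. -/
theorem isIntegerDTFamily_single (hQ : IsAcyclicQuiver V) {θ : V → ℝ} (hθ : IsGenericWeight θ)
    {i : V} (hi : θ i = 0) :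
    IsIntegerDTFamily θ fun d => if d = Pi.single i 1 then 1 else 0 := by
  classical
  have hsingle : ∀ n : V →₀ ℕ, weightPairing θ n = 0 → n = Finsupp.single i (n i) := by
    intro n hn
    ext j
    by_cases hj : j = i
    · subst hj; simp
    rw [Finsupp.single_eq_of_ne hj]
    exact hθ.eq_zero_of_eq_zero (d := Pi.single i 1) (by rw [weightPairing_single, hi, zero_mul]) hn
      (by simp) (Pi.single_eq_of_ne hj 1)
  have hpair : ∀ k : ℕ, weightPairing θ (Finsupp.single i k) = 0 := fun k => by
    rw [Finsupp.single_eq_pi_single, weightPairing_single, hi, zero_mul]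
  have harg : dtSeries θ (fun d => if d = Pi.single i 1 then 1 else 0) =
      MvPowerSeries.C (yVar⁻¹ - yVar)⁻¹ * MvPowerSeries.X i := by
    ext n
    rw [coeff_dtSeries, MvPowerSeries.coeff_C_mul, MvPowerSeries.coeff_X]
    by_cases hn : n = Finsupp.single i 1
    · subst hn
      rw [if_pos ⟨hpair 1, by simp⟩, if_pos (Finsupp.single_eq_pi_single i 1), if_pos rfl, mul_one,
        one_div]
    · have hn' : (n : V → ℕ) ≠ Pi.single i 1 := fun h => hn <| DFunLike.coe_injective <| by
        rw [h, Finsupp.single_eq_pi_single]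
      rw [if_neg hn', if_neg hn, zero_div, ite_self, mul_zero]
  rw [isIntegerDTFamily_iff, harg]
  ext n
  rw [coeff_plethysticExp_inv_sub_mul_X, coeff_stackySeries]
  by_cases hn : n = Finsupp.single i (n i)
  · rw [if_pos hn]
    conv_lhs => rw [hn]
    rw [if_pos (hpair _), Finsupp.single_eq_pi_single, stackyInvariant_single hQ (Or.inl hi)]
  · rw [if_neg hn, if_neg fun h => hn (hsingle n h)]

theorem neBot_nhdsWithin_genericWeights {d : V → ℕ} (hd : d ≠ 0) :
    (𝓝[genericWeights d] selfWeight d).NeBot :=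
  mem_closure_iff_nhdsWithin_neBot.1
    (orthogonalWeights_subset_closure_genericWeights hd (weightPairing_selfWeight d))

theorem hasAttractorInvariant_single (hQ : IsAcyclicQuiver V) (i : V) {n : ℕ} (hn : n ≠ 0) :
    HasAttractorInvariant (Pi.single i n : V → ℕ) (if n = 1 then 1 else 0) := by
  have hd0 : (Pi.single i n : V → ℕ) ≠ 0 := by simpa using hn
  refine ⟨neBot_nhdsWithin_genericWeights hd0, ?_⟩
  filter_upwards [self_mem_nhdsWithin] with θ hθ
  -- Orthogonality to `n e_i` alone gives this; closeness to the self-stability weight is not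
  -- needed.
  have hθi : θ i = 0 := by
    have := hθ.1
    rw [weightPairing_single] at this
    exact (mul_eq_zero.1 this).resolve_right (Nat.cast_ne_zero.2 hn)
  have := (isIntegerDTFamily_single hQ hθ.2 hθi).hasIntegerDT hθ.1 hd0
  have hiff : (Pi.single i n : V → ℕ) = Pi.single i 1 ↔ n = 1 :=
    (Pi.single_injective (M := fun _ : V => ℕ) i).eq_iff
  simpa only [hiff] using this

/-- If the support of `d` has at least two vertices, then all generic weights in `d^⊥` close to the
self-stability weight are positive at some sink of the support. -/
theorem eventually_exists_sink_pos (hQ : IsAcyclicQuiver V) {d : V → ℕ} {k l : V} (hkl : k ≠ l)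
    (hk : d k ≠ 0) (hl : d l ≠ 0) :
    ∀ᶠ θ in 𝓝[genericWeights d] selfWeight d,
      ∃ i, d i ≠ 0 ∧ (∀ j, d j ≠ 0 → IsEmpty (i ⟶ j)) ∧ 0 < θ i := by
  by_cases hA : ∃ i, d i ≠ 0 ∧ (∀ j, d j ≠ 0 → IsEmpty (i ⟶ j)) ∧ 0 < selfWeight d i
  · obtain ⟨i, hdi, hi, hpos⟩ := hA
    have hcont : Filter.Tendsto (fun θ : V → ℝ => θ i) (𝓝[genericWeights d] selfWeight d)
        (𝓝 (selfWeight d i)) := ((continuous_apply i).tendsto _).mono_left nhdsWithin_le_nhds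
    filter_upwards [hcont.eventually (lt_mem_nhds hpos)] with θ hθ
    exact ⟨i, hdi, hi, hθ⟩
  -- An arrow inside the support would give a sink of positive self-weight: take a sink among the
  -- support vertices that receive an arrow from the support.
  · have hiso : ∀ i, d i ≠ 0 → ∀ j, d j ≠ 0 → IsEmpty (i ⟶ j) := by
      by_contra! hex
      obtain ⟨i, hdi, j, hdj, ⟨a⟩⟩ := hex
      obtain ⟨s, ⟨hds, m, hdm, ⟨b⟩⟩, hs⟩ := hQ.exists_sink
        (P := {s | d s ≠ 0 ∧ ∃ m, d m ≠ 0 ∧ Nonempty (m ⟶ s)}) ⟨j, hdj, i, hdi, ⟨a⟩⟩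
      have hsink : ∀ t, d t ≠ 0 → IsEmpty (s ⟶ t) := fun t ht =>
        ⟨fun c => (hs t ⟨ht, s, hds, ⟨c⟩⟩).false c⟩
      refine hA ⟨s, hds, hsink, ?_⟩
      rw [selfWeight_of_sink hsink]
      refine Finset.sum_pos' (fun t _ => by positivity) ⟨m, Finset.mem_univ m, ?_⟩
      have h1 : 0 < Fintype.card (m ⟶ s) := Fintype.card_pos_iff.2 ⟨b⟩
      have h2 : 0 < d m := Nat.pos_of_ne_zero hdm
      positivity
    filter_upwards [self_mem_nhdsWithin] with θ hθ
    -- With no arrows in the support every vertex of it is a sink, and genericity does the rest: `θ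
    -- k = 0` would put `e_k`, whose support omits `l`, in the kernel. So the zero sum `∑ θ_i d_i`
    -- has a nonzero term, hence a positive one.
    have hθk : θ k ≠ 0 := fun h => hl <| hθ.2.eq_zero_of_eq_zero (d := Pi.single k 1)
      (by rw [weightPairing_single, h, zero_mul]) hθ.1
      (by simp) (Pi.single_eq_of_ne hkl.symm 1)
    obtain ⟨i, -, hi⟩ := Finset.exists_pos_of_sum_zero_of_exists_nonzero
      (fun i => θ i * (d i : ℝ)) hθ.1
      ⟨k, Finset.mem_univ k, mul_ne_zero hθk (Nat.cast_ne_zero.2 hk)⟩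
    have hdi : d i ≠ 0 := by
      intro h
      rw [h, Nat.cast_zero, mul_zero] at hi
      exact lt_irrefl _ hi
    exact ⟨i, hdi, hiso i hdi, pos_of_mul_pos_left hi (Nat.cast_nonneg _)⟩

theorem hasAttractorInvariant_zero (hQ : IsAcyclicQuiver V) {d : V → ℕ} {k l : V} (hkl : k ≠ l)
    (hk : d k ≠ 0) (hl : d l ≠ 0) : HasAttractorInvariant d 0 := by
  have hd0 : d ≠ 0 := fun h => hk (congrFun h k)
  refine ⟨neBot_nhdsWithin_genericWeights hd0, ?_⟩
  filter_upwards [eventually_exists_sink_pos hQ hkl hk hl, self_mem_nhdsWithin]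
    with θ ⟨i, hdi, hi, hpos⟩ hθ
  exact (isIntegerDTFamily_zero hQ hθ.2 hθ.1 hdi hi hpos).hasIntegerDT hθ.1 hd0

end Attractor

end QuiverDT

theorem mainTheorem4 {V : Type u} [Quiver.{v} V] [Fintype V] [DecidableEq V]
    [∀ i j : V, Fintype (i ⟶ j)] (hQ : IsAcyclicQuiver V) :
    (∀ M : QRep.{u, v, w} V,
      M.IsSelfStable ↔ ∃ j : V, Nonempty (M.Iso (vertexSimple j))) ∧
    (∀ i : V, HasAttractorInvariant (Pi.single i 1 : V → ℕ) 1) ∧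
    (∀ d : V → ℕ, d ≠ 0 → (∀ i : V, d ≠ Pi.single i 1) → HasAttractorInvariant d 0) ∧
    ((fun n : Unit →₀ ℕ => (-yVar) ^ (n () ^ 2) / vP (GLSet (n ())) :
        MvPowerSeries Unit (RatFunc ℚ)) =
      plethysticExp (MvPowerSeries.C (yVar⁻¹ - yVar)⁻¹ * MvPowerSeries.X ())) := by
  refine ⟨isSelfStable_iff hQ, fun i => ?_, fun d hd0 hd => ?_, sum_GL_eq_plethysticExp⟩
  · simpa using hasAttractorInvariant_single hQ i one_ne_zero
  · obtain ⟨i, hi⟩ := Function.ne_iff.1 hd0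
    -- Either the support has a second vertex, or `d = n e_i` with `n ≥ 2`, whose invariant vanishes
    -- because only `e_i` carries one.
    by_cases h : ∃ l, i ≠ l ∧ d l ≠ 0
    · obtain ⟨l, hil, hl⟩ := h
      exact hasAttractorInvariant_zero hQ hil hi hl
    · push Not at h
      have hdi : d = Pi.single i (d i) := by
        funext j
        by_cases hj : j = i
        · subst hj; simp
        · rw [Pi.single_eq_of_ne hj, h j (Ne.symm hj)]
      have h1 : d i ≠ 1 := fun h1 => hd i (by rw [← h1]; exact hdi)
      rw [hdi]
      simpa [h1] using hasAttractorInvariant_single hQ i hi
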